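/- Let $F$ be a $p$-adic field, that is, a field with a nontrivial non-archimedean absolute value $|\cdot|$ for which it is locally compact (for example a finite extension of $\mathbb{Q}_p$). Let $\mathcal{O}_F=\{x\in F : |x|\le 1\}$ and let $\varpi$ be a generator of the maximal ideal of $\mathcal{O}_F$. Let $n\ge 1$ and $m\ge 1$ be integers, and let $$K=K_m=\{x\in \mathrm{GL}_n(F) : \max_{i,j}|(1-x)_{ij}|\le |\varpi|^m\},$$ a congruence subgroup of $\mathrm{GL}_n(\mathcal{O}_F)$. Let $(\pi,V)$ be an irreducible complex representation of $\mathrm{GL}_n(F)$ that is smooth (every vector is fixed by some compact open subgroup) and admissible (the space of vectors fixed by any given compact open subgroup is finite-dimensional). Then the space $V^K$ of $K$-fixed vectors satisfies $$\dim_{\mathbb{C}} V^K\le [\mathrm{GL}_n(\mathcal{O}_F):K]^n\cdot n^{n/2}.$$ Moreover, for $n\ge 3$ this bound is strictly smaller than Bernstein's bound $[\mathrm{GL}_n(\mathcal{O}_F):K]^{2^{n-1}}$: $$[\mathrm{GL}_n(\mathcal{O}_F):K]^n\cdot n^{n/2}<[\mathrm{GL}_n(\mathcal{O}_F):K]^{2^{n-1}}.$$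 -/

import Mathlib

open scoped MatrixGroups

namespace UniformAdmissibility

section Representations

variable {G V : Type*} [Group G] [AddCommGroup V] [Module ℂ V]

/-- The subspace `V^K` of vectors fixed by every element of the subgroup `K`. -/
noncomputable def fixedVectors (π : Representation ℂ G V) (K : Subgroup G) : Submodule ℂ V :=
  Representation.invariants (π.comp K.subtype)

variable [TopologicalSpace G]

/-- Every vector is fixed by some compact open subgroup. -/
def IsSmooth (π : Representation ℂ G V) : Prop :=
  ∀ v : V, ∃ K : Subgroup G, IsOpen (K : Set G) ∧ IsCompact (K : Set G) ∧
    ∀ g ∈ K, π g v = v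

/-- `V^K` is finite-dimensional for every compact open subgroup `K`. -/
def IsAdmissible (π : Representation ℂ G V) : Prop :=
  ∀ K : Subgroup G, IsOpen (K : Set G) → IsCompact (K : Set G) →
    FiniteDimensional ℂ (fixedVectors π K)

end Representations

section Groups

theorem one_entry_le {E : Type*} [NormedField E] {n : ℕ} (i j : Fin n) :
    ‖(1 : Matrix (Fin n) (Fin n) E) i j‖ ≤ 1 := by
  rw [Matrix.one_apply]; split <;> simp

variable (F : Type*) [NontriviallyNormedField F] [IsUltrametricDist F]

/-- The ring of integers `{x : F | ‖x‖ ≤ 1}`. -/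
noncomputable abbrev integers : ValuationSubring F :=
  (NormedField.valuation (K := F)).valuationSubring

/-- The subgroup `GL_n(O_F)` of `GL_n(F)`. -/
noncomputable def integralGL (n : ℕ) : Subgroup (GL (Fin n) F) :=
  (Matrix.GeneralLinearGroup.map (n := Fin n) (algebraMap (integers F) F)).range

variable {F}

/-- `ϖ` generates the maximal ideal of the ring of integers. -/
def IsUniformizer (ϖ : integers F) : Prop :=
  IsLocalRing.maximalIdeal (integers F) = Ideal.span {ϖ}

theorem IsUniformizer.norm_lt_one {ϖ : integers F} (h : IsUniformizer ϖ) : ‖(ϖ : F)‖ < 1 := by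
  have h1 : ϖ ∈ IsLocalRing.maximalIdeal (integers F) := by
    rw [h]; exact Ideal.mem_span_singleton_self ϖ
  have h2 := (Valuation.mem_maximalIdeal_iff (v := NormedField.valuation (K := F)) (a := ϖ)).1 h1
  exact h2

theorem mul_entry_le {n : ℕ} {A B : Matrix (Fin n) (Fin n) F} {a b : ℝ} (ha : 0 ≤ a) (hb : 0 ≤ b)
    (hA : ∀ i j, ‖A i j‖ ≤ a) (hB : ∀ i j, ‖B i j‖ ≤ b) (i j : Fin n) :
    ‖(A * B) i j‖ ≤ a * b := by
  rw [Matrix.mul_apply]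
  refine IsUltrametricDist.norm_sum_le_of_forall_le_of_nonneg (mul_nonneg ha hb) fun k _ => ?_
  rw [norm_mul]
  exact mul_le_mul (hA i k) (hB k j) (norm_nonneg _) ha

theorem add_entry_le {x y : F} {c : ℝ} (hx : ‖x‖ ≤ c) (hy : ‖y‖ ≤ c) : ‖x + y‖ ≤ c :=
  (IsUltrametricDist.norm_add_le_max x y).trans (max_le hx hy)

theorem inv_entry_le {n : ℕ} {c : ℝ} (hc0 : 0 ≤ c) (hc1 : c < 1) (x : GL (Fin n) F)
    (hx : ∀ i j, ‖(1 - (x : Matrix (Fin n) (Fin n) F)) i j‖ ≤ c) (i j : Fin n) :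
    ‖((x⁻¹ : GL (Fin n) F) : Matrix (Fin n) (Fin n) F) i j‖ ≤ 1 := by
  set y : Matrix (Fin n) (Fin n) F := ((x⁻¹ : GL (Fin n) F) : Matrix (Fin n) (Fin n) F) with hy
  have hyx : y * (x : Matrix (Fin n) (Fin n) F) = 1 := by
    rw [hy, ← Units.val_mul, inv_mul_cancel, Units.val_one]
  have key : y = 1 + y * (1 - (x : Matrix (Fin n) (Fin n) F)) := by
    rw [mul_sub, hyx, mul_one]; abel
  obtain ⟨p, -, hp⟩ := Finset.exists_max_image (Finset.univ : Finset (Fin n × Fin n))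
    (fun p => ‖y p.1 p.2‖) ⟨(i, j), Finset.mem_univ _⟩
  have hM : ∀ k l, ‖y k l‖ ≤ ‖y p.1 p.2‖ := fun k l => hp (k, l) (Finset.mem_univ _)
  have h2 := mul_entry_le (norm_nonneg _) hc0 hM hx p.1 p.2
  have h3 : ‖y p.1 p.2‖ ≤ max 1 (‖y p.1 p.2‖ * c) := by
    have : y p.1 p.2 = (1 : Matrix (Fin n) (Fin n) F) p.1 p.2 +
        (y * (1 - (x : Matrix (Fin n) (Fin n) F))) p.1 p.2 := by
      rw [← Matrix.add_apply, ← key]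
    calc ‖y p.1 p.2‖ = _ := congrArg norm this
      _ ≤ _ := IsUltrametricDist.norm_add_le_max _ _
      _ ≤ _ := max_le_max (one_entry_le _ _) h2
  refine (hM i j).trans ?_
  rcases le_max_iff.1 h3 with h | h
  · exact h
  · nlinarith [norm_nonneg (y p.1 p.2)]

/-- The congruence subgroup `K_m = {x ∈ GL_n(F) | ‖1 - x‖ ≤ ‖ϖ‖ ^ m}` for `m ≥ 1`, where
`‖·‖` of a matrix is the maximum of the absolute values of its entries. -/
def congruenceSubgroup (n : ℕ) {ϖ : integers F} (hϖ : IsUniformizer ϖ) (m : ℕ) (hm : 1 ≤ m) :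
    Subgroup (GL (Fin n) F) where
  carrier := {x | ∀ i j, ‖(1 - (x : Matrix (Fin n) (Fin n) F)) i j‖ ≤ ‖(ϖ : F)‖ ^ m}
  one_mem' := fun i j => by simp
  mul_mem' := by
    intro x y hx hy i j
    have hc1 : ‖(ϖ : F)‖ ^ m ≤ 1 := pow_le_one₀ (norm_nonneg _) hϖ.norm_lt_one.le
    have e : 1 - ((x * y : GL (Fin n) F) : Matrix (Fin n) (Fin n) F)
        = (1 - (x : Matrix (Fin n) (Fin n) F)) + x * (1 - (y : Matrix (Fin n) (Fin n) F)) := by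
      rw [Units.val_mul, mul_sub, mul_one]; abel
    have hx1 : ∀ k l, ‖(x : Matrix (Fin n) (Fin n) F) k l‖ ≤ 1 := fun k l => by
      have : (x : Matrix (Fin n) (Fin n) F) k l = (1 : Matrix (Fin n) (Fin n) F) k l +
          -((1 - (x : Matrix (Fin n) (Fin n) F)) k l) := by
        rw [Matrix.sub_apply]; ring
      rw [this]
      exact add_entry_le (one_entry_le k l) (by rw [norm_neg]; exact (hx k l).trans hc1)
    rw [e, Matrix.add_apply]
    refine add_entry_le (hx i j) ?_
    simpa using mul_entry_le zero_le_one (by positivity) hx1 hy i j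
  inv_mem' := by
    intro x hx i j
    have hc1 : ‖(ϖ : F)‖ ^ m < 1 := pow_lt_one₀ (norm_nonneg _) hϖ.norm_lt_one (by omega)
    have e : 1 - ((x⁻¹ : GL (Fin n) F) : Matrix (Fin n) (Fin n) F)
        = -(((x⁻¹ : GL (Fin n) F) : Matrix (Fin n) (Fin n) F) *
          (1 - (x : Matrix (Fin n) (Fin n) F))) := by
      rw [mul_sub, mul_one, ← Units.val_mul, inv_mul_cancel, Units.val_one]; abel
    rw [e, Matrix.neg_apply, norm_neg]
    simpa using mul_entry_le zero_le_one (by positivity)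
      (inv_entry_le (by positivity) hc1 x hx) hx i j

end Groups

end UniformAdmissibility

/-!
Write `K = K_m`, `K₀ = GL_n(O_F)`, `N = [K₀ : K]` and `D = dim V^K`. By irreducibility and
Burnside's theorem the Hecke operators `e π(g) e`, with `e` the averaging projection onto `V^K`,
span `End(V^K)`. Since `K₀` normalizes `K`, the Cartan decomposition `g = P d Q` writes each of them
as one of `N` operators, times the operator of a dominant diagonal matrix `d`, times one of `N`
operators. The Iwahori factorization of `K` makes `d ↦ e π(d) e` multiplicative on dominant
matrices, so up to scalars and units of `K₀` these operators lie in the commutative algebra `C`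
generated by the `n - 1` fundamental coweights. Hence `D ^ 2 ≤ N ^ 2 * dim C`. On the other hand,
commuting operators `x₁, …, x_{n-1}` on a `D`-dimensional space generate an algebra whose dimension
`A` satisfies `A ^ n ≤ n ^ n * D ^ (2 * (n - 1))`. The two bounds combine to
`D ^ 2 ≤ N ^ (2 * n) * n ^ n`.
-/

namespace UniformAdmissibility

section LinearAlgebra

open Module Polynomial

variable {k : Type*} [Field k]
variable {V : Type*} [AddCommGroup V] [Module k V] {W : Type*} [AddCommGroup W] [Module k W]

theorem finrank_eigenspace_restrict {f : End k V} {U : Submodule k V} (hU : ∀ u ∈ U, f u ∈ U)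
    (c : k) : finrank k (End.eigenspace (f.restrict hU) c) =
      finrank k ↥(End.eigenspace f c ⊓ U) := by
  rw [inf_comm]
  exact .trans (Submodule.finrank_map_subtype_eq U _).symm
    (congrArg (fun S : Submodule k V => finrank k S) (Submodule.inf_genEigenspace f U hU).symm)

/-- The linear maps `φ : V → W` with `φ ∘ f = f' ∘ φ`. -/
def intertwiners (f : End k V) (f' : End k W) : Submodule k (V →ₗ[k] W) :=
  LinearMap.eqLocus (LinearMap.lcomp k W f) (LinearMap.compRight k f')

theorem mem_intertwiners {f : End k V} {f' : End k W} {φ : V →ₗ[k] W} :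
    φ ∈ intertwiners f f' ↔ ∀ v, φ (f v) = f' (φ v) :=
  LinearMap.ext_iff

variable [FiniteDimensional k V]

theorem finrank_ker_inf_range_add_finrank_range_mul (f g : End k V) :
    finrank k ↥(LinearMap.ker f ⊓ LinearMap.range g) + finrank k (LinearMap.range (f * g)) =
      finrank k (LinearMap.range g) := by
  have h := (f.domRestrict (LinearMap.range g)).finrank_range_add_finrank_ker
  rw [LinearMap.range_domRestrict, ← LinearMap.range_comp, LinearMap.ker_domRestrict,
    ← Submodule.finrank_map_subtype_eq, Submodule.map_comap_subtype, inf_comm, add_comm] at h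
  exact h

theorem finrank_eigenspace_dualMap (f : End k V) (c : k) :
    finrank k (End.eigenspace (M := Dual k V) f.dualMap c) = finrank k (f.eigenspace c) := by
  have hdual : f.dualMap - c • (1 : End k (Dual k V)) =
      (f - c • (1 : End k V)).dualMap := by
    ext ℓ v
    simp only [LinearMap.sub_apply, LinearMap.smul_apply, End.one_apply,
      LinearMap.dualMap_apply, map_sub, map_smul, smul_eq_mul]
  have h := (f - c • 1).finrank_range_add_finrank_ker
  have h' := (f - c • 1).dualMap.finrank_range_add_finrank_ker
  rw [LinearMap.finrank_range_dualMap_eq_finrank_range, Subspace.dual_finrank_eq, ← h] at h'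
  rw [End.eigenspace_def, End.eigenspace_def, hdual]
  exact Nat.add_left_cancel h'

theorem finrank_intertwiners_le_add [FiniteDimensional k W] (f : End k V) {f' : End k W}
    {ℓ : Dual k W} {c : k} (hℓ : ∀ w, ℓ (f' w) = c * ℓ w)
    (hker : ∀ w ∈ LinearMap.ker ℓ, f' w ∈ LinearMap.ker ℓ) :
    finrank k (intertwiners f f') ≤
      finrank k (f.eigenspace c) + finrank k (intertwiners f (f'.restrict hker)) := by
  let Φ : intertwiners f f' →ₗ[k] Dual k V := (ℓ.compRight k).domRestrict _
  have hrange : LinearMap.range Φ ≤ End.eigenspace (M := Dual k V) f.dualMap c := by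
    rintro _ ⟨⟨φ, hφ⟩, rfl⟩
    refine End.mem_eigenspace_iff.2 (LinearMap.ext fun v => ?_)
    exact (congrArg ℓ (mem_intertwiners.1 hφ v)).trans (hℓ _)
  let Ψ : LinearMap.ker Φ →ₗ[k] intertwiners f (f'.restrict hker) :=
    { toFun := fun φ => ⟨φ.1.1.codRestrict _ (LinearMap.congr_fun (LinearMap.mem_ker.1 φ.2)),
        mem_intertwiners.2 fun v => Subtype.ext (mem_intertwiners.1 φ.1.2 v)⟩
      map_add' := fun _ _ => rfl
      map_smul' := fun _ _ => rfl }
  have hΨ : Function.Injective Ψ := fun φ φ' h => by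
    ext v
    exact congrArg Subtype.val (LinearMap.congr_fun (congrArg Subtype.val h) v)
  calc finrank k (intertwiners f f')
      = finrank k (LinearMap.range Φ) + finrank k (LinearMap.ker Φ) :=
        Φ.finrank_range_add_finrank_ker.symm
    _ ≤ _ := add_le_add
        ((Submodule.finrank_mono hrange).trans_eq (finrank_eigenspace_dualMap f c))
        (LinearMap.finrank_le_finrank_of_injective hΨ)

theorem finrank_intertwiners_le [IsAlgClosed k] [FiniteDimensional k W] {f : End k V} {g : ℕ}
    (hg : ∀ c, finrank k (f.eigenspace c) ≤ g) (f' : End k W) :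
    finrank k (intertwiners f f') ≤ g * finrank k W := by
  induction hN : finrank k W generalizing W with
  | zero =>
    have : Subsingleton W := finrank_zero_iff.1 hN
    simp only [finrank_zero_of_subsingleton, mul_zero, le_refl]
  | succ N ih =>
    have : Nontrivial W := nontrivial_of_finrank_pos (R := k) (hN ▸ N.succ_pos)
    obtain ⟨c, hc⟩ := End.exists_eigenvalue (K := k) (V := Dual k W) f'.dualMap
    obtain ⟨ℓ, hℓ⟩ := hc.exists_hasEigenvector
    have hℓf (w : W) : ℓ (f' w) = c * ℓ w := LinearMap.congr_fun hℓ.apply_eq_smul w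
    have hker : ∀ w ∈ LinearMap.ker ℓ, f' w ∈ LinearMap.ker ℓ := fun w hw => by
      rw [LinearMap.mem_ker] at hw ⊢
      rw [hℓf, hw, mul_zero]
    have hkerN : finrank k (LinearMap.ker ℓ) = N := by
      have := Dual.finrank_ker_add_one_of_ne_zero hℓ.2
      omega
    calc finrank k (intertwiners f f')
        ≤ finrank k (f.eigenspace c) + finrank k (intertwiners f (f'.restrict hker)) :=
          finrank_intertwiners_le_add f hℓf hker
      _ ≤ g + g * N := add_le_add (hg c) (ih _ hkerN)
      _ = g * (N + 1) := by ring

theorem finrank_map_mulRight_centralizer_le [IsAlgClosed k] {x q : End k V} (hq : Commute x q)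
    {g : ℕ} (hg : ∀ c, finrank k ↥(x.eigenspace c ⊓ LinearMap.range q) ≤ g) :
    finrank k ((Subalgebra.centralizer k {x}).toSubmodule.map (LinearMap.mulRight k q)) ≤
      g * finrank k V := by
  have hx : ∀ w ∈ LinearMap.range q, x w ∈ LinearMap.range q := by
    rintro _ ⟨v, rfl⟩
    exact ⟨x v, (LinearMap.congr_fun hq v).symm⟩
  have hle : (Subalgebra.centralizer k {x}).toSubmodule.map (LinearMap.mulRight k q) ≤
      (intertwiners (x.restrict hx) x).map (LinearMap.lcomp k V q.rangeRestrict) := by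
    rintro _ ⟨y, hy, rfl⟩
    have hyx : x * y = y * x := (Subalgebra.mem_centralizer_iff k).1 hy x rfl
    exact ⟨y.domRestrict _,
      mem_intertwiners.2 fun w => (LinearMap.congr_fun hyx w.1).symm, rfl⟩
  calc _ ≤ finrank k (intertwiners (x.restrict hx) x) :=
        (Submodule.finrank_mono hle).trans (Submodule.finrank_map_le _ _)
    _ ≤ g * finrank k V :=
        finrank_intertwiners_le (fun c => (finrank_eigenspace_restrict hx c).trans_le (hg c)) x

theorem exists_monic_finrank_eigenspace_inf_range_mul_le (x : End k V) {r : ℕ} (hr : 0 < r) :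
    ∃ p : k[X], p.Monic ∧ p.natDegree < r ∧
      ∀ c, finrank k ↥(x.eigenspace c ⊓ LinearMap.range (aeval x p)) * r ≤ finrank k V := by
  -- Otherwise one could multiply `p` by `r` successive factors `X - c`, each of which lowers the
  -- rank of `p(x)` by more than `dim V / r`.
  by_contra! hdrop
  have hrank (j : ℕ) (hj : j ≤ r) : ∃ p : k[X], p.Monic ∧ p.natDegree = j ∧
      finrank k (LinearMap.range (aeval x p)) * r + j * (finrank k V + 1) ≤ finrank k V * r := by
    induction j with
    | zero =>
      refine ⟨1, monic_one, natDegree_one, ?_⟩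
      rw [zero_mul, add_zero]
      exact Nat.mul_le_mul_right r (Submodule.finrank_le _)
    | succ j ih =>
      obtain ⟨p, hp, rfl, hpr⟩ := ih (Nat.le_of_succ_le hj)
      obtain ⟨c, hc⟩ := hdrop p hp hj
      refine ⟨(X - C c) * p, (monic_X_sub_C c).mul hp, ?_, ?_⟩
      · rw [(monic_X_sub_C c).natDegree_mul hp, natDegree_X_sub_C, add_comm]
      · have hadd := finrank_ker_inf_range_add_finrank_range_mul
          (x - c • 1) (aeval x p)
        rw [← End.eigenspace_def] at hadd
        rw [map_mul, map_sub, aeval_X, aeval_C, Algebra.algebraMap_eq_smul_one]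
        rw [← hadd] at hpr
        nlinarith
  obtain ⟨p, -, -, hp⟩ := hrank r le_rfl
  nlinarith

theorem exists_monic_finrank_map_mulRight_centralizer_mul_le [IsAlgClosed k] (x : End k V)
    {r : ℕ} (hr : 0 < r) :
    ∃ p : k[X], p.Monic ∧ p.natDegree < r ∧
      finrank k ((Subalgebra.centralizer k {x}).toSubmodule.map
        (LinearMap.mulRight k (aeval x p))) * r ≤ finrank k V ^ 2 := by
  obtain ⟨p, hp, hpr, hdim⟩ := exists_monic_finrank_eigenspace_inf_range_mul_le x hr
  refine ⟨p, hp, hpr, ?_⟩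
  have hle := finrank_map_mulRight_centralizer_le (q := aeval x p)
    (by simpa only [aeval_X] using (commute_X p).map (aeval x))
    (fun c => (Nat.le_div_iff_mul_le hr).2 (hdim c))
  calc _ ≤ finrank k V / r * finrank k V * r := Nat.mul_le_mul_right r hle
    _ = finrank k V / r * r * finrank k V := by ring
    _ ≤ finrank k V ^ 2 := by
      rw [sq]
      exact Nat.mul_le_mul_right _ (Nat.div_mul_le_self _ _)

theorem finrank_adjoin_singleton_le_natDegree {A : Type*} [CommRing A] [Algebra k A] {x : A}
    {p : k[X]} (hp : p.Monic) (hx : aeval x p = 0) :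
    finrank k (Algebra.adjoin k {x}) ≤ p.natDegree := by
  let φ : AdjoinRoot p →ₐ[k] A := AdjoinRoot.liftAlgHom p (Algebra.ofId k A) x hx
  have hle : Subalgebra.toSubmodule (Algebra.adjoin k {x}) ≤ LinearMap.range φ.toLinearMap :=
    Algebra.adjoin_le (S := φ.range) (by
      rintro _ rfl
      exact ⟨AdjoinRoot.root p, AdjoinRoot.liftAlgHom_root _ _ _ _⟩)
  have := hp.finite_adjoinRoot
  calc finrank k (Algebra.adjoin k {x}) ≤ finrank k (AdjoinRoot p) :=
        (Submodule.finrank_mono hle).trans (LinearMap.finrank_range_le _)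
    _ = p.natDegree := (AdjoinRoot.powerBasis' hp).finrank

theorem finrank_adjoin_range_le_prod_natDegree {A : Type*} [CommRing A] [Algebra k A]
    {ι : Type*} [Fintype ι] {x : ι → A} {p : ι → k[X]} (hp : ∀ i, (p i).Monic)
    (hx : ∀ i, aeval (x i) (p i) = 0) :
    finrank k (Algebra.adjoin k (Set.range x)) ≤ ∏ i, (p i).natDegree := by
  classical
  have hsup (s : Finset ι) :
      finrank k ↥(s.sup fun i => Algebra.adjoin k {x i}) ≤ ∏ i ∈ s, (p i).natDegree := by
    induction s using Finset.induction_on with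
    | empty =>
      rw [Finset.sup_empty, Finset.prod_empty]
      nontriviality A
      exact Subalgebra.finrank_bot.le
    | insert i s his ih =>
      rw [Finset.sup_insert, Finset.prod_insert his]
      exact (Subalgebra.finrank_sup_le_of_free _ _).trans
        (Nat.mul_le_mul (finrank_adjoin_singleton_le_natDegree (hp i) (hx i)) ih)
  rw [← Set.iUnion_singleton_eq_range, Algebra.adjoin_iUnion, ← Finset.sup_univ_eq_iSup]
  exact hsup Finset.univ

theorem finrank_quotient_le_prod_natDegree {A : Type*} [CommRing A] [Algebra k A] {ι : Type*}
    [Fintype ι] {x : ι → A} (hx : Algebra.adjoin k (Set.range x) = ⊤) {J : Ideal A} {p : ι → k[X]}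
    (hp : ∀ i, (p i).Monic) (hJ : ∀ i, aeval (x i) (p i) ∈ J) :
    finrank k (A ⧸ J) ≤ ∏ i, (p i).natDegree := by
  let mk := Ideal.Quotient.mkₐ k J
  have hadjoin : Algebra.adjoin k (Set.range fun i => mk (x i)) = ⊤ := by
    rw [Set.range_comp' mk x, ← AlgHom.map_adjoin, hx, Algebra.map_top, AlgHom.range_eq_top]
    exact Ideal.Quotient.mkₐ_surjective k J
  have hroot (i : ι) : aeval (mk (x i)) (p i) = 0 := by
    rw [aeval_algHom_apply]
    exact Ideal.Quotient.eq_zero_iff_mem.2 (hJ i)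
  rw [← finrank_top, ← Algebra.top_toSubmodule, ← hadjoin]
  exact finrank_adjoin_range_le_prod_natDegree hp hroot

theorem finrank_iSup_le_sum {ι : Type*} [Fintype ι] (S : ι → Submodule k V) :
    finrank k ↥(⨆ i, S i) ≤ ∑ i, finrank k (S i) := by
  classical
  have hsup (s : Finset ι) : finrank k ↥(s.sup S) ≤ ∑ i ∈ s, finrank k (S i) := by
    induction s using Finset.induction_on with
    | empty => rw [Finset.sup_empty, finrank_bot, Finset.sum_empty]
    | insert i s his ih =>
      rw [Finset.sup_insert, Finset.sum_insert his]
      exact (Submodule.finrank_add_le_finrank_add_finrank _ _).trans (Nat.add_le_add_left ih _)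
  rw [← Finset.sup_univ_eq_iSup]
  exact hsup Finset.univ

section CommRing

variable [IsAlgClosed k] {R : Type*} [CommRing R] [Algebra k R] {ψ : R →ₐ[k] End k V}

theorem exists_monic_finrank_span_singleton_mul_le (hψ : Function.Injective ψ) (x : R) {r : ℕ}
    (hr : 0 < r) :
    ∃ p : k[X], p.Monic ∧ p.natDegree < r ∧
      finrank k ((Ideal.span {aeval x p}).restrictScalars k) * r ≤ finrank k V ^ 2 := by
  obtain ⟨p, hp, hpr, hdim⟩ := exists_monic_finrank_map_mulRight_centralizer_mul_le (ψ x) hr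
  refine ⟨p, hp, hpr, le_trans (Nat.mul_le_mul_right r ?_) hdim⟩
  rw [(Submodule.equivMapOfInjective ψ.toLinearMap hψ _).finrank_eq]
  refine Submodule.finrank_mono ?_
  rintro _ ⟨a, ha, rfl⟩
  obtain ⟨b, rfl⟩ := Ideal.mem_span_singleton'.1 ha
  refine ⟨ψ b, (Subalgebra.mem_centralizer_iff k).2 ?_, ?_⟩
  · rintro _ rfl
    rw [← map_mul, ← map_mul, mul_comm]
  · rw [aeval_algHom_apply]
    exact (map_mul ψ _ _).symm

theorem finrank_mul_le_add_of_adjoin_eq_top (hψ : Function.Injective ψ) {ι : Type*} [Fintype ι]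
    {x : ι → R} (hx : Algebra.adjoin k (Set.range x) = ⊤) {r : ℕ} (hr : 0 < r) :
    finrank k R * r ≤ Fintype.card ι * finrank k V ^ 2 + (r - 1) ^ Fintype.card ι * r := by
  have : FiniteDimensional k R := Module.Finite.of_injective ψ.toLinearMap hψ
  choose p hp hpr hdim using fun i => exists_monic_finrank_span_singleton_mul_le hψ (x i) hr
  let J : Ideal R := Ideal.span (Set.range fun i => aeval (x i) (p i))
  have hJ : finrank k (J.restrictScalars k) * r ≤ Fintype.card ι * finrank k V ^ 2 := by
    have hsup : finrank k (J.restrictScalars k) ≤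
        ∑ i, finrank k ((Ideal.span {aeval (x i) (p i)}).restrictScalars k) := by
      rw [show J = _ from Ideal.span_range_eq_iSup _, Submodule.restrictScalars_iSup]
      exact finrank_iSup_le_sum _
    calc _ ≤ _ := Nat.mul_le_mul_right r hsup
      _ ≤ ∑ _i : ι, finrank k V ^ 2 := by
        rw [Finset.sum_mul]
        exact Finset.sum_le_sum fun i _ => hdim i
      _ = _ := by rw [Finset.sum_const, Finset.card_univ, smul_eq_mul]
  have hquot : finrank k (R ⧸ J) ≤ (r - 1) ^ Fintype.card ι :=
    calc finrank k (R ⧸ J) ≤ ∏ i, (p i).natDegree :=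
          finrank_quotient_le_prod_natDegree hx hp fun i => Ideal.subset_span ⟨i, rfl⟩
      _ ≤ ∏ _i : ι, (r - 1) := Finset.prod_le_prod' fun i _ => Nat.le_sub_one_of_lt (hpr i)
      _ = _ := by rw [Finset.prod_const, Finset.card_univ]
  have hsum : finrank k (R ⧸ J) + finrank k (J.restrictScalars k) = finrank k R :=
    (J.restrictScalars k).finrank_quotient_add_finrank
  calc finrank k R * r = finrank k (J.restrictScalars k) * r + finrank k (R ⧸ J) * r := by
        rw [← hsum]; ring
    _ ≤ _ := add_le_add hJ (Nat.mul_le_mul_right r hquot)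

end CommRing

theorem pow_succ_le_of_forall_mul_le {a l e : ℕ}
    (h : ∀ r, 0 < r → a * r ≤ l * e + (r - 1) ^ l * r) :
    a ^ (l + 1) ≤ (l + 1) ^ (l + 1) * e ^ l := by
  obtain ⟨t, ht, hte⟩ : ∃ t : ℝ, 0 ≤ t ∧ t ^ (l + 1) = e :=
    ⟨(e : ℝ) ^ ((l + 1 : ℕ) : ℝ)⁻¹, by positivity,
      Real.rpow_inv_natCast_pow e.cast_nonneg l.succ_ne_zero⟩
  have hr := h (⌊t⌋₊ + 1) (Nat.succ_pos _)
  rw [Nat.add_sub_cancel] at hr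
  have hlt : t ≤ ⌊t⌋₊ + 1 := (Nat.lt_floor_add_one t).le
  have hat : (a : ℝ) ≤ (l + 1) * t ^ l := by
    refine le_of_mul_le_mul_right ?_ (Nat.cast_add_one_pos (α := ℝ) ⌊t⌋₊)
    calc (a : ℝ) * (⌊t⌋₊ + 1) ≤ l * t ^ (l + 1) + (⌊t⌋₊ : ℝ) ^ l * (⌊t⌋₊ + 1) := by
          rw [hte]
          exact_mod_cast hr
      _ ≤ l * (t ^ l * (⌊t⌋₊ + 1)) + t ^ l * (⌊t⌋₊ + 1) := by
          rw [pow_succ]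
          gcongr
          exact Nat.floor_le ht
      _ = (l + 1) * t ^ l * (⌊t⌋₊ + 1) := by ring
  have hpow : (a : ℝ) ^ (l + 1) ≤ (l + 1) ^ (l + 1) * (e : ℝ) ^ l :=
    calc (a : ℝ) ^ (l + 1) ≤ ((l + 1) * t ^ l) ^ (l + 1) := by gcongr
      _ = (l + 1) ^ (l + 1) * (t ^ (l + 1)) ^ l := by rw [mul_pow, pow_right_comm]
      _ = (l + 1) ^ (l + 1) * (e : ℝ) ^ l := by rw [hte]
  exact_mod_cast hpow

open scoped IsMulCommutative in
theorem finrank_adjoin_range_pow_le [IsAlgClosed k] {ι : Type*} [Fintype ι] {x : ι → End k V}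
    (hx : ∀ i j, Commute (x i) (x j)) :
    finrank k (Algebra.adjoin k (Set.range x)) ^ (Fintype.card ι + 1) ≤
      (Fintype.card ι + 1) ^ (Fintype.card ι + 1) * (finrank k V ^ 2) ^ Fintype.card ι := by
  let A := Algebra.adjoin k (Set.range x)
  have : IsMulCommutative A := Algebra.isMulCommutative_adjoin k (by
    rintro _ ⟨i, rfl⟩ _ ⟨j, rfl⟩
    exact hx i j)
  let y (i : ι) : A := ⟨x i, Algebra.subset_adjoin ⟨i, rfl⟩⟩
  have hy : Algebra.adjoin k (Set.range y) = ⊤ := by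
    refine eq_top_iff.2 (Algebra.adjoin_adjoin_coe_preimage.symm.le.trans (Algebra.adjoin_mono ?_))
    rintro ⟨_, h⟩ ⟨i, rfl⟩
    exact ⟨i, rfl⟩
  exact pow_succ_le_of_forall_mul_le fun r hr =>
    finrank_mul_le_add_of_adjoin_eq_top (ψ := A.val) Subtype.val_injective hy hr

theorem subalgebra_eq_top_of_isSimpleModule [IsAlgClosed k] (S : Subalgebra k (End k V))
    [IsSimpleModule S V] : S = ⊤ := by
  have hschur := (IsSimpleModule.algebraMap_end_bijective_of_isAlgClosed k (A := S) (V := V)).2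
  have : Module.Finite (End S V) V := Module.Finite.of_restrictScalars_finite k _ _
  refine eq_top_iff.2 fun f _ => ?_
  let F : End (End S V) V :=
    { f with
      map_smul' := fun φ v => by
        obtain ⟨c, rfl⟩ := hschur φ
        exact f.map_smul c v }
  obtain ⟨s, hs⟩ := Module.Finite.toModuleEnd_moduleEnd_surjective (R := S) (M := V) F
  have hsf : s.1 = f := LinearMap.ext fun v => LinearMap.congr_fun hs v
  exact hsf ▸ s.2

end LinearAlgebra

section MatrixGroups

open Matrix

section Border

variable {F : Type*} {n : ℕ}

/-- The block matrix with corner `a`, rest of the first row `r`, rest of the first column `c` and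
remaining block `M`. -/
def borderMatrix (a : F) (r c : Fin n → F) (M : Matrix (Fin n) (Fin n) F) :
    Matrix (Fin (n + 1)) (Fin (n + 1)) F :=
  Matrix.of (Fin.cons (Fin.cons a r) fun i => Fin.cons (c i) (M i))

theorem eq_borderMatrix (A : Matrix (Fin (n + 1)) (Fin (n + 1)) F) :
    A = borderMatrix (A 0 0) (fun j => A 0 j.succ) (fun i => A i.succ 0)
      (Matrix.of fun i j => A i.succ j.succ) := by
  ext i j
  cases i using Fin.cases <;> cases j using Fin.cases <;> rfl

theorem forall_borderMatrix_iff {p : F → Prop} {a : F} {r c : Fin n → F}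
    {M : Matrix (Fin n) (Fin n) F} :
    (∀ i j, p (borderMatrix a r c M i j)) ↔
      (p a ∧ ∀ j, p (r j)) ∧ ∀ i, p (c i) ∧ ∀ j, p (M i j) := by
  simp only [Fin.forall_fin_succ]
  rfl

theorem borderMatrix_zero_zero_diagonal [Zero F] (a : F) (d : Fin n → F) :
    borderMatrix a 0 0 (Matrix.diagonal d) = Matrix.diagonal (Fin.cons a d : Fin (n + 1) → F) := by
  ext i j
  cases i using Fin.cases <;> cases j using Fin.cases <;>
    simp [borderMatrix, Matrix.diagonal_apply, Fin.succ_ne_zero, (Fin.succ_ne_zero _).symm]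

theorem borderMatrix_one [Zero F] [One F] :
    borderMatrix (1 : F) 0 0 (1 : Matrix (Fin n) (Fin n) F) = 1 := by
  rw [← Matrix.diagonal_one, borderMatrix_zero_zero_diagonal, ← Matrix.diagonal_one]
  congr 1
  ext i
  cases i using Fin.cases <;> rfl

theorem one_sub_borderMatrix [Ring F] (a : F) (r c : Fin n → F) (M : Matrix (Fin n) (Fin n) F) :
    1 - borderMatrix a r c M = borderMatrix (1 - a) (-r) (-c) (1 - M) := by
  rw [← borderMatrix_one]
  ext i j
  cases i using Fin.cases <;> cases j using Fin.cases <;> simp [borderMatrix]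

theorem borderMatrix_mul [CommRing F] (a a' : F) (r c r' c' : Fin n → F)
    (M M' : Matrix (Fin n) (Fin n) F) :
    borderMatrix a r c M * borderMatrix a' r' c' M' =
      borderMatrix (a * a' + r ⬝ᵥ c') (a • r' + r ᵥ* M') (a' • c + M *ᵥ c')
        (vecMulVec c r' + M * M') := by
  ext i j
  rw [Matrix.mul_apply, Fin.sum_univ_succ]
  cases i using Fin.cases <;> cases j using Fin.cases <;>
    simp [borderMatrix, dotProduct, vecMul, mulVec, vecMulVec_apply, Matrix.mul_apply, mul_comm]

theorem isLowerTriangular_borderMatrix [Zero F] {L : Matrix (Fin n) (Fin n) F}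
    (hL : L.IsLowerTriangular) (a : F) (c : Fin n → F) :
    (borderMatrix a 0 c L).IsLowerTriangular := by
  intro i j hij
  cases j using Fin.cases with
  | zero => exact absurd hij (Fin.zero_le i).not_gt
  | succ j =>
    cases i using Fin.cases with
    | zero => rfl
    | succ i => exact hL (Fin.succ_lt_succ_iff.1 hij)

theorem isUpperTriangular_borderMatrix [Zero F] {U : Matrix (Fin n) (Fin n) F}
    (hU : U.IsUpperTriangular) (a : F) (r : Fin n → F) :
    (borderMatrix a r 0 U).IsUpperTriangular := by
  intro i j hij
  cases i using Fin.cases with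
  | zero => exact absurd hij (Fin.zero_le j).not_gt
  | succ i =>
    cases j using Fin.cases with
    | zero => rfl
    | succ j => exact hU (Fin.succ_lt_succ_iff.1 hij)

end Border

section Groups

variable {F : Type*} [Field F] {n : ℕ}

/-- `1 ⊕ g` as an element of `GL_{n+1}`. -/
def oneSumGL (g : GL (Fin n) F) : GL (Fin (n + 1)) F :=
  ⟨borderMatrix 1 0 0 g.1, borderMatrix 1 0 0 g⁻¹.1,
    by rw [borderMatrix_mul, Units.mul_inv]; simp [borderMatrix_one],
    by rw [borderMatrix_mul, Units.inv_mul]; simp [borderMatrix_one]⟩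

/-- The unipotent matrix that differs from `1` only in its first row `(1, r)`. -/
def rowGL (r : Fin n → F) : GL (Fin (n + 1)) F :=
  ⟨borderMatrix 1 r 0 1, borderMatrix 1 (-r) 0 1, by simp [borderMatrix_mul, borderMatrix_one],
    by simp [borderMatrix_mul, borderMatrix_one]⟩

/-- The unipotent matrix that differs from `1` only in its first column `(1, c)`. -/
def colGL (c : Fin n → F) : GL (Fin (n + 1)) F :=
  ⟨borderMatrix 1 0 c 1, borderMatrix 1 0 (-c) 1, by simp [borderMatrix_mul, borderMatrix_one],
    by simp [borderMatrix_mul, borderMatrix_one]⟩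

/-- The permutation matrix of `σ` as an element of `GL_n`. -/
def permGL (F : Type*) [Field F] (σ : Equiv.Perm (Fin n)) : GL (Fin n) F :=
  ⟨σ.permMatrix F, σ⁻¹.permMatrix F, by rw [← Matrix.permMatrix_mul]; simp,
    by rw [← Matrix.permMatrix_mul]; simp⟩

theorem permGL_mul_mul_permGL_apply (σ τ : Equiv.Perm (Fin n)) (A : Matrix (Fin n) (Fin n) F)
    (i j : Fin n) : ((permGL F σ).1 * A * (permGL F τ).1) i j = A (σ i) (τ⁻¹ j) := by
  simp [permGL, PEquiv.toMatrix_toPEquiv_mul, PEquiv.mul_toMatrix_toPEquiv]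

/-- The diagonal torus of `GL_n`. -/
def diagGL : (Fin n → Fˣ) →* GL (Fin n) F where
  toFun d := ⟨Matrix.diagonal fun i => (d i : F), Matrix.diagonal fun i => ((d i)⁻¹ : Fˣ),
    by simp [Matrix.diagonal_mul_diagonal], by simp [Matrix.diagonal_mul_diagonal]⟩
  map_one' := Units.ext (by simp)
  map_mul' a b := Units.ext (by simp [Matrix.diagonal_mul_diagonal])

theorem coe_diagGL (d : Fin n → Fˣ) :
    (diagGL d : Matrix (Fin n) (Fin n) F) = Matrix.diagonal fun i => (d i : F) :=
  rfl

theorem diagGL_conj_apply (d : Fin n → Fˣ) (g : GL (Fin n) F) (i j : Fin n) :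
    (diagGL d * g * (diagGL d)⁻¹).1 i j = d i * g.1 i j * (d j : F)⁻¹ := by
  rw [← map_inv, Units.val_mul, Units.val_mul, coe_diagGL, coe_diagGL, Matrix.mul_diagonal,
    Matrix.diagonal_mul, Pi.inv_apply, Units.val_inv_eq_inv_val]

theorem diagGL_const_mem_center (c : Fˣ) :
    diagGL (fun _ => c) ∈ Subgroup.center (GL (Fin n) F) := by
  rw [Subgroup.mem_center_iff]
  intro g
  ext i j
  simp [coe_diagGL, mul_comm]

end Groups

section Integral

variable {F : Type*} [NontriviallyNormedField F] [IsUltrametricDist F] {n : ℕ}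

theorem mem_integralGL_iff {g : GL (Fin n) F} :
    g ∈ integralGL F n ↔ (∀ i j, ‖g.1 i j‖ ≤ 1) ∧ ∀ i j, ‖g⁻¹.1 i j‖ ≤ 1 := by
  constructor
  · rintro ⟨h, rfl⟩
    refine ⟨fun i j => (h.1 i j).2, fun i j => ?_⟩
    rw [← map_inv]
    exact (h⁻¹.1 i j).2
  · rintro ⟨hg, hg'⟩
    have hinj : Function.Injective ((algebraMap (integers F) F).mapMatrix (m := Fin n)) :=
      Matrix.map_injective Subtype.val_injective
    let A : Matrix (Fin n) (Fin n) (integers F) := Matrix.of fun i j => ⟨g.1 i j, hg i j⟩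
    let B : Matrix (Fin n) (Fin n) (integers F) := Matrix.of fun i j => ⟨g⁻¹.1 i j, hg' i j⟩
    refine ⟨⟨A, B, hinj ?_, hinj ?_⟩, Units.ext rfl⟩
    · rw [map_mul, map_one]
      exact Units.mul_inv g
    · rw [map_mul, map_one]
      exact Units.inv_mul g

theorem norm_mul_mul_le_of_mem_integralGL {P Q : GL (Fin n) F} (hP : P ∈ integralGL F n)
    (hQ : Q ∈ integralGL F n) {A : Matrix (Fin n) (Fin n) F} {b : ℝ} (hb : 0 ≤ b)
    (hA : ∀ i j, ‖A i j‖ ≤ b) (i j : Fin n) : ‖(P.1 * A * Q.1) i j‖ ≤ b := by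
  simpa only [one_mul, mul_one] using mul_entry_le (by positivity) zero_le_one
    (mul_entry_le zero_le_one hb (mem_integralGL_iff.1 hP).1 hA) (mem_integralGL_iff.1 hQ).1 i j

theorem permGL_mem_integralGL (σ : Equiv.Perm (Fin n)) : permGL F σ ∈ integralGL F n := by
  have hle (τ : Equiv.Perm (Fin n)) (i j : Fin n) : ‖τ.permMatrix F i j‖ ≤ 1 := by
    rw [Equiv.Perm.permMatrix, PEquiv.toMatrix_apply]
    split_ifs <;> simp
  exact mem_integralGL_iff.2 ⟨hle σ, hle σ⁻¹⟩

theorem oneSumGL_mem_integralGL {g : GL (Fin n) F} (hg : g ∈ integralGL F n) :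
    oneSumGL g ∈ integralGL F (n + 1) := by
  have hle {M : Matrix (Fin n) (Fin n) F} (hM : ∀ i j, ‖M i j‖ ≤ 1) :
      ∀ i j, ‖borderMatrix 1 0 0 M i j‖ ≤ 1 :=
    (forall_borderMatrix_iff (p := (‖·‖ ≤ 1))).2 (by simpa using hM)
  exact mem_integralGL_iff.2 ((mem_integralGL_iff.1 hg).imp hle hle)

theorem rowGL_mem_integralGL {r : Fin n → F} (hr : ∀ i, ‖r i‖ ≤ 1) :
    rowGL r ∈ integralGL F (n + 1) := by
  have hle {s : Fin n → F} (hs : ∀ i, ‖s i‖ ≤ 1) : ∀ i j, ‖borderMatrix 1 s 0 1 i j‖ ≤ 1 :=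
    (forall_borderMatrix_iff (p := (‖·‖ ≤ 1))).2 (by simpa [one_entry_le] using hs)
  exact mem_integralGL_iff.2 ⟨hle hr, hle (by simpa using hr)⟩

theorem colGL_mem_integralGL {c : Fin n → F} (hc : ∀ i, ‖c i‖ ≤ 1) :
    colGL c ∈ integralGL F (n + 1) := by
  have hle {s : Fin n → F} (hs : ∀ i, ‖s i‖ ≤ 1) : ∀ i j, ‖borderMatrix 1 0 s 1 i j‖ ≤ 1 :=
    (forall_borderMatrix_iff (p := (‖·‖ ≤ 1))).2 (by simpa [one_entry_le] using hs)
  exact mem_integralGL_iff.2 ⟨hle hc, hle (by simpa using hc)⟩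

theorem diagGL_mem_integralGL {d : Fin n → Fˣ} (hd : ∀ i, ‖(d i : F)‖ = 1) :
    diagGL d ∈ integralGL F n := by
  have hle {e : Fin n → F} (he : ∀ i, ‖e i‖ = 1) (i j : Fin n) : ‖Matrix.diagonal e i j‖ ≤ 1 := by
    rw [Matrix.diagonal_apply]
    split_ifs <;> simp [he]
  exact mem_integralGL_iff.2 ⟨hle hd, hle (by simpa using hd)⟩

theorem isCompact_integralGL [LocallyCompactSpace F] :
    IsCompact (integralGL F n : Set (GL (Fin n) F)) := by
  have : ProperSpace F := ProperSpace.of_nontriviallyNormedField_of_weaklyLocallyCompactSpace F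
  let B : Set (Matrix (Fin n) (Fin n) F) :=
    Set.univ.pi fun _ => Set.univ.pi fun _ => Metric.closedBall 0 1
  have hB : IsCompact B :=
    isCompact_univ_pi fun _ => isCompact_univ_pi fun _ => isCompact_closedBall 0 1
  have hmem (A : Matrix (Fin n) (Fin n) F) : A ∈ B ↔ ∀ i j, ‖A i j‖ ≤ 1 :=
    ⟨fun h i j => mem_closedBall_zero_iff.1 (h i trivial j trivial),
      fun h i _ j _ => mem_closedBall_zero_iff.2 (h i j)⟩
  have hpre : (integralGL F n : Set (GL (Fin n) F)) =
      Units.embedProduct _ ⁻¹' (B ×ˢ (MulOpposite.unop ⁻¹' B)) := by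
    ext g
    rw [SetLike.mem_coe, mem_integralGL_iff, ← hmem, ← hmem]
    rfl
  rw [hpre]
  exact Units.isClosedEmbedding_embedProduct.isCompact_preimage
    (hB.prod (MulOpposite.opHomeomorph.symm.isClosedEmbedding.isCompact_preimage hB))

end Integral

section Cartan

variable {F : Type*} [NontriviallyNormedField F] [IsUltrametricDist F] {n : ℕ}

/-- Equivalence of matrices under row and column operations defined over the ring of integers. -/
def IntegralEquiv (A B : Matrix (Fin n) (Fin n) F) : Prop :=
  ∃ P ∈ integralGL F n, ∃ Q ∈ integralGL F n, P.1 * A * Q.1 = B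

theorem IntegralEquiv.trans {A B C : Matrix (Fin n) (Fin n) F} (hAB : IntegralEquiv A B)
    (hBC : IntegralEquiv B C) : IntegralEquiv A C := by
  obtain ⟨P, hP, Q, hQ, rfl⟩ := hAB
  obtain ⟨P', hP', Q', hQ', rfl⟩ := hBC
  refine ⟨P' * P, mul_mem hP' hP, Q * Q', mul_mem hQ hQ', ?_⟩
  simp only [Units.val_mul, Matrix.mul_assoc]

theorem IntegralEquiv.norm_le {A B : Matrix (Fin n) (Fin n) F} (hAB : IntegralEquiv A B) {b : ℝ}
    (hb : 0 ≤ b) (hA : ∀ i j, ‖A i j‖ ≤ b) (i j : Fin n) : ‖B i j‖ ≤ b := by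
  obtain ⟨P, hP, Q, hQ, rfl⟩ := hAB
  exact norm_mul_mul_le_of_mem_integralGL hP hQ hb hA i j

theorem IntegralEquiv.borderMatrix {A B : Matrix (Fin n) (Fin n) F} (hAB : IntegralEquiv A B)
    (a : F) : IntegralEquiv (borderMatrix a 0 0 A) (borderMatrix a 0 0 B) := by
  obtain ⟨P, hP, Q, hQ, rfl⟩ := hAB
  refine ⟨oneSumGL P, oneSumGL_mem_integralGL hP, oneSumGL Q, oneSumGL_mem_integralGL hQ, ?_⟩
  simp [oneSumGL, borderMatrix_mul]

theorem exists_integralEquiv_norm_le_corner (A : Matrix (Fin (n + 1)) (Fin (n + 1)) F) :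
    ∃ B, IntegralEquiv A B ∧ ∀ i j, ‖B i j‖ ≤ ‖B 0 0‖ := by
  obtain ⟨⟨i₀, j₀⟩, hmax⟩ := Finite.exists_max fun p : Fin (n + 1) × Fin (n + 1) => ‖A p.1 p.2‖
  refine ⟨_, ⟨permGL F (Equiv.swap 0 i₀), permGL_mem_integralGL _, permGL F (Equiv.swap 0 j₀),
    permGL_mem_integralGL _, rfl⟩, fun i j => ?_⟩
  simp only [permGL_mul_mul_permGL_apply, Equiv.swap_inv, Equiv.swap_apply_left]
  exact hmax (_, _)

theorem exists_integralEquiv_borderMatrix_zero_zero {a : F} {r c : Fin n → F}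
    (hr : ∀ j, ‖r j‖ ≤ ‖a‖) (hc : ∀ i, ‖c i‖ ≤ ‖a‖) (M : Matrix (Fin n) (Fin n) F) :
    ∃ M', IntegralEquiv (borderMatrix a r c M) (borderMatrix a 0 0 M') := by
  have hquot {x : F} (hx : ‖x‖ ≤ ‖a‖) : ‖-(x / a)‖ ≤ 1 := by
    rw [norm_neg, norm_div]
    exact div_le_one_of_le₀ hx (norm_nonneg _)
  have hclear {v : Fin n → F} (hv : ∀ i, ‖v i‖ ≤ ‖a‖) : (a • fun i => -(v i / a)) + v = 0 := by
    ext i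
    have hmul : a * (v i / a) = v i :=
      mul_div_cancel_of_imp' fun h => norm_le_zero_iff.1 (by simpa [h] using hv i)
    simp [hmul]
  refine ⟨vecMulVec (fun i => -(c i / a)) r + M, colGL fun i => -(c i / a),
    colGL_mem_integralGL fun i => hquot (hc i), rowGL fun j => -(r j / a),
    rowGL_mem_integralGL fun j => hquot (hr j), ?_⟩
  simp only [colGL, rowGL]
  rw [borderMatrix_mul, borderMatrix_mul]
  simp [hclear hc, hclear hr]

theorem exists_integralEquiv_diagonal (A : Matrix (Fin n) (Fin n) F) :
    ∃ d : Fin n → F, Antitone (fun i => ‖d i‖) ∧ IntegralEquiv A (Matrix.diagonal d) := by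
  induction n with
  | zero => exact ⟨0, fun i => i.elim0, 1, one_mem _, 1, one_mem _, Subsingleton.elim _ _⟩
  | succ n ih =>
    obtain ⟨B, hAB, hB⟩ := exists_integralEquiv_norm_le_corner A
    obtain ⟨M, hBM⟩ := exists_integralEquiv_borderMatrix_zero_zero (fun j : Fin n => hB 0 j.succ)
      (fun i => hB i.succ 0) (Matrix.of fun i j => B i.succ j.succ)
    rw [← eq_borderMatrix] at hBM
    obtain ⟨d, hd, hMd⟩ := ih M
    have hM (i j : Fin n) : ‖M i j‖ ≤ ‖B 0 0‖ := hBM.norm_le (norm_nonneg _) hB i.succ j.succ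
    refine ⟨Fin.cons (B 0 0) d, ?_, ?_⟩
    · intro i j hij
      cases i using Fin.cases with
      | zero =>
        cases j using Fin.cases with
        | zero => rfl
        | succ j => simpa using hMd.norm_le (norm_nonneg _) hM j j
      | succ i =>
        cases j using Fin.cases with
        | zero => exact absurd hij (Fin.succ_pos i).not_ge
        | succ j => exact hd (Fin.succ_le_succ_iff.1 hij)
    · rw [← borderMatrix_zero_zero_diagonal]
      exact (hAB.trans hBM).trans (hMd.borderMatrix _)

theorem exists_cartan_decomposition (g : GL (Fin n) F) :
    ∃ P ∈ integralGL F n, ∃ Q ∈ integralGL F n, ∃ d : Fin n → Fˣ,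
      Antitone (fun i => ‖(d i : F)‖) ∧ g = P * diagGL d * Q := by
  obtain ⟨d, hd, P, hP, Q, hQ, hPQ⟩ := exists_integralEquiv_diagonal g.1
  have hunit : IsUnit (Matrix.diagonal d) := hPQ ▸ (P * g * Q).isUnit
  have hd0 (i : Fin n) : d i ≠ 0 := ((Pi.isUnit_iff.1 (isUnit_diagonal.1 hunit)) i).ne_zero
  have hdiag : P * g * Q = diagGL fun i => Units.mk0 (d i) (hd0 i) := Units.ext hPQ
  refine ⟨P⁻¹, inv_mem hP, Q⁻¹, inv_mem hQ, fun i => Units.mk0 (d i) (hd0 i), hd, ?_⟩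
  rw [← hdiag]
  group

end Cartan

section Congruence

variable {F : Type*} [NontriviallyNormedField F] [IsUltrametricDist F] {ϖ : integers F}

theorem IsUniformizer.norm_le (hϖ : IsUniformizer ϖ) {x : F} (hx : ‖x‖ < 1) :
    ‖x‖ ≤ ‖(ϖ : F)‖ := by
  have hmem : (⟨x, hx.le⟩ : integers F) ∈ IsLocalRing.maximalIdeal (integers F) :=
    (Valuation.mem_maximalIdeal_iff (v := NormedField.valuation (K := F))).2 hx
  rw [hϖ, Ideal.mem_span_singleton] at hmem
  obtain ⟨y, hy⟩ := hmem
  have hxy : x = ϖ * y := congrArg Subtype.val hy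
  rw [hxy, norm_mul]
  exact mul_le_of_le_one_right (norm_nonneg _) y.2

theorem IsUniformizer.norm_pos (hϖ : IsUniformizer ϖ) : 0 < ‖(ϖ : F)‖ := by
  obtain ⟨x, hx0, hx1⟩ := NormedField.exists_norm_lt_one F
  exact hx0.trans_le (hϖ.norm_le hx1)

theorem IsUniformizer.norm_pow_lt_one (hϖ : IsUniformizer ϖ) {m : ℕ} (hm : 1 ≤ m) :
    ‖(ϖ : F)‖ ^ m < 1 :=
  pow_lt_one₀ (norm_nonneg _) hϖ.norm_lt_one (Nat.one_le_iff_ne_zero.1 hm)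

theorem IsUniformizer.exists_norm_eq_pow (hϖ : IsUniformizer ϖ) {x : F} (hx0 : x ≠ 0)
    (hx1 : ‖x‖ ≤ 1) : ∃ e : ℕ, ‖x‖ = ‖(ϖ : F)‖ ^ e := by
  obtain ⟨e, hlt, hle⟩ :=
    exists_nat_pow_near_of_lt_one (norm_pos_iff.2 hx0) hx1 hϖ.norm_pos hϖ.norm_lt_one
  have hpow : 0 < ‖(ϖ : F) ^ e‖ := by simpa only [norm_pow] using pow_pos hϖ.norm_pos e
  refine ⟨e, hle.eq_of_not_lt fun h => hlt.not_ge ?_⟩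
  rw [← norm_pow] at h
  have hquot : ‖x / (ϖ : F) ^ e‖ ≤ ‖(ϖ : F)‖ :=
    hϖ.norm_le (by rwa [norm_div, div_lt_one hpow])
  rwa [norm_div, div_le_iff₀ hpow, norm_pow, ← pow_succ'] at hquot

variable {n : ℕ} (hϖ : IsUniformizer ϖ) {m : ℕ} (hm : 1 ≤ m)

theorem congruenceSubgroup_le_integralGL : congruenceSubgroup n hϖ m hm ≤ integralGL F n := by
  have hinv {y : GL (Fin n) F} (hy : y ∈ congruenceSubgroup n hϖ m hm) (i j : Fin n) :
      ‖y⁻¹.1 i j‖ ≤ 1 := inv_entry_le (by positivity) (hϖ.norm_pow_lt_one hm) y hy i j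
  intro x hx
  exact mem_integralGL_iff.2 ⟨by simpa only [inv_inv] using hinv (inv_mem hx), hinv hx⟩

theorem conj_mem_congruenceSubgroup {g x : GL (Fin n) F} (hg : g ∈ integralGL F n)
    (hx : x ∈ congruenceSubgroup n hϖ m hm) : g * x * g⁻¹ ∈ congruenceSubgroup n hϖ m hm := by
  intro i j
  have hconj : 1 - (g * x * g⁻¹ : GL (Fin n) F).1 = g.1 * (1 - x.1) * g⁻¹.1 := by
    rw [mul_sub, sub_mul, mul_one, Units.mul_inv, Units.val_mul, Units.val_mul]
  rw [hconj]
  exact norm_mul_mul_le_of_mem_integralGL hg (inv_mem hg) (by positivity) hx i j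

theorem integralGL_le_normalizer_congruenceSubgroup : integralGL F n ≤
    Subgroup.normalizer (congruenceSubgroup n hϖ m hm : Set (GL (Fin n) F)) :=
  fun g hg => Subgroup.mem_normalizer_iff.2 fun x =>
    ⟨conj_mem_congruenceSubgroup hϖ hm hg, fun hx => by
      simpa [mul_assoc] using conj_mem_congruenceSubgroup hϖ hm (inv_mem hg) hx⟩

theorem isOpen_congruenceSubgroup : IsOpen (congruenceSubgroup n hϖ m hm : Set (GL (Fin n) F)) := by
  have hball : (congruenceSubgroup n hϖ m hm : Set (GL (Fin n) F)) = ⋂ i, ⋂ j,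
      (fun x : GL (Fin n) F => (1 - x.1) i j) ⁻¹' Metric.closedBall 0 (‖(ϖ : F)‖ ^ m) := by
    ext x
    simp only [Set.mem_iInter, Set.mem_preimage, mem_closedBall_zero_iff]
    rfl
  rw [hball]
  refine isOpen_iInter_of_finite fun i => isOpen_iInter_of_finite fun j => ?_
  refine (IsUltrametricDist.isOpen_closedBall _ (pow_pos hϖ.norm_pos m).ne').preimage ?_
  exact (continuous_const.sub Units.continuous_val).matrix_elem i j

theorem isCompact_congruenceSubgroup [LocallyCompactSpace F] :
    IsCompact (congruenceSubgroup n hϖ m hm : Set (GL (Fin n) F)) :=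
  isCompact_integralGL.of_isClosed_subset
    (Subgroup.isClosed_of_isOpen _ (isOpen_congruenceSubgroup hϖ hm))
    (congruenceSubgroup_le_integralGL hϖ hm)

theorem relIndex_ne_zero_of_isOpen_of_isCompact {G : Type*} [Group G] [TopologicalSpace G]
    [IsTopologicalGroup G] {N K : Subgroup G} (hN : IsOpen (N : Set G))
    (hK : IsCompact (K : Set G)) : N.relIndex K ≠ 0 := by
  have : CompactSpace K := isCompact_iff_compactSpace.1 hK
  have := Subgroup.quotient_finite_of_isOpen (N.subgroupOf K) (hN.preimage continuous_subtype_val)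
  exact Subgroup.index_ne_zero_of_finite

theorem factorial_le_relIndex [LocallyCompactSpace F] :
    n.factorial ≤ (congruenceSubgroup n hϖ m hm).relIndex (integralGL F n) := by
  have hindex := relIndex_ne_zero_of_isOpen_of_isCompact (isOpen_congruenceSubgroup (n := n) hϖ hm)
    isCompact_integralGL
  have hfin := Nat.finite_of_card_ne_zero hindex
  have hcard : n.factorial = Nat.card (Equiv.Perm (Fin n)) := by rw [Nat.card_perm, Nat.card_fin]
  rw [hcard]
  refine Nat.card_le_card_of_injective
    (fun σ => (⟨permGL F σ, permGL_mem_integralGL σ⟩ : integralGL F n) :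
      Equiv.Perm (Fin n) → integralGL F n ⧸ (congruenceSubgroup n hϖ m hm).subgroupOf _)
    fun σ τ hστ => ?_
  have hmem : (permGL F σ)⁻¹ * permGL F τ ∈ congruenceSubgroup n hϖ m hm := by
    simpa [Subgroup.mem_subgroupOf] using QuotientGroup.eq.1 hστ
  have hsub : (permGL F σ).1 * (1 - ((permGL F σ)⁻¹ * permGL F τ).1) =
      (permGL F σ).1 - (permGL F τ).1 := by
    rw [mul_sub, mul_one, ← Units.val_mul, mul_inv_cancel_left]
  ext i
  by_contra hne
  have hentry : ((permGL F σ).1 - (permGL F τ).1) i (σ i) = 1 := by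
    have hτσ : τ i ≠ σ i := fun h => hne (congrArg Fin.val h.symm)
    simp [permGL, PEquiv.toMatrix_apply, hτσ]
  have hle := mul_entry_le zero_le_one (by positivity)
    (mem_integralGL_iff.1 (permGL_mem_integralGL (F := F) σ)).1 hmem i (σ i)
  rw [hsub, hentry, norm_one, one_mul] at hle
  exact (hϖ.norm_pow_lt_one hm).not_ge hle

end Congruence

section Triangular

variable {F : Type*} [NontriviallyNormedField F] [IsUltrametricDist F] {n : ℕ}

theorem exists_isLowerTriangular_mul_isUpperTriangular {c : ℝ} (hc : c < 1)
    {A : Matrix (Fin n) (Fin n) F} (hA : ∀ i j, ‖(1 - A) i j‖ ≤ c) :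
    ∃ L U : Matrix (Fin n) (Fin n) F, A = L * U ∧ L.IsLowerTriangular ∧ U.IsUpperTriangular ∧
      (∀ i j, ‖(1 - L) i j‖ ≤ c) ∧ ∀ i j, ‖(1 - U) i j‖ ≤ c := by
  induction n with
  | zero => exact ⟨1, 1, Subsingleton.elim _ _, fun i => i.elim0, fun i => i.elim0,
      fun i => i.elim0, fun i => i.elim0⟩
  | succ n ih =>
    have hc0 : 0 ≤ c := (norm_nonneg _).trans (hA 0 0)
    obtain ⟨a, r, v, M, rfl⟩ : ∃ a r v M, A = borderMatrix a r v M :=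
      ⟨_, _, _, _, eq_borderMatrix A⟩
    rw [one_sub_borderMatrix, forall_borderMatrix_iff (p := (‖·‖ ≤ c))] at hA
    simp only [Pi.neg_apply, norm_neg] at hA
    obtain ⟨⟨ha, hr⟩, hvM⟩ := hA
    have ha1 : ‖a‖ = 1 := by
      rw [← norm_neg, ← norm_one (α := F)]
      refine (IsUltrametricDist.norm_eq_of_add_norm_lt_max ?_).symm
      rw [← sub_eq_add_neg]
      exact ha.trans_lt (hc.trans_le (le_max_of_le_left norm_one.ge))
    have ha0 : a ≠ 0 := norm_ne_zero_iff.1 (ha1 ▸ one_ne_zero)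
    have hav (i : Fin n) : ‖(a⁻¹ • v) i‖ ≤ c := by simpa [norm_mul, ha1] using (hvM i).1
    have hschur (i j : Fin n) : ‖(1 - (M - vecMulVec (a⁻¹ • v) r)) i j‖ ≤ c := by
      rw [sub_sub_eq_add_sub, add_sub_right_comm, Matrix.add_apply, vecMulVec_apply]
      refine add_entry_le ((hvM i).2 j) ?_
      rw [norm_mul]
      exact (mul_le_of_le_one_right (norm_nonneg _) ((hr j).trans hc.le)).trans (hav i)
    obtain ⟨L, U, hLU, hL, hU, hLc, hUc⟩ := ih hschur
    refine ⟨borderMatrix 1 0 (a⁻¹ • v) L, borderMatrix a r 0 U, ?_,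
      isLowerTriangular_borderMatrix hL _ _, isUpperTriangular_borderMatrix hU _ _, ?_, ?_⟩
    · rw [borderMatrix_mul, ← hLU]
      simp [smul_smul, ha0]
    · rw [one_sub_borderMatrix]
      refine (forall_borderMatrix_iff (p := (‖·‖ ≤ c))).2 ⟨?_, fun i => ⟨?_, hLc i⟩⟩
      · simp [hc0]
      · simpa using hav i
    · rw [one_sub_borderMatrix]
      refine (forall_borderMatrix_iff (p := (‖·‖ ≤ c))).2 ⟨⟨ha, ?_⟩, fun i => ⟨?_, hUc i⟩⟩
      · simpa using hr
      · simpa using hc0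

variable {ϖ : integers F} {hϖ : IsUniformizer ϖ} {m : ℕ} {hm : 1 ≤ m}

theorem exists_isLowerTriangular_mul_isUpperTriangular_of_mem_congruenceSubgroup
    {k : GL (Fin n) F} (hk : k ∈ congruenceSubgroup n hϖ m hm) :
    ∃ y ∈ congruenceSubgroup n hϖ m hm, ∃ z ∈ congruenceSubgroup n hϖ m hm,
      k = y * z ∧ y.1.IsLowerTriangular ∧ z.1.IsUpperTriangular := by
  obtain ⟨L, U, hLU, hL, hU, hLc, hUc⟩ :=
    exists_isLowerTriangular_mul_isUpperTriangular (hϖ.norm_pow_lt_one hm) hk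
  have hdet : L.det * U.det ≠ 0 := by
    rw [← Matrix.det_mul, ← hLU]
    exact (Matrix.isUnits_det_units k).ne_zero
  exact ⟨GeneralLinearGroup.mkOfDetNeZero L (left_ne_zero_of_mul hdet), hLc,
    GeneralLinearGroup.mkOfDetNeZero U (right_ne_zero_of_mul hdet), hUc, Units.ext hLU, hL, hU⟩

theorem diagGL_conj_mem_congruenceSubgroup {d : Fin n → Fˣ} {g : GL (Fin n) F}
    (hg : g ∈ congruenceSubgroup n hϖ m hm)
    (hd : ∀ i j, g.1 i j ≠ 0 → ‖(d i : F)‖ ≤ ‖(d j : F)‖) :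
    diagGL d * g * (diagGL d)⁻¹ ∈ congruenceSubgroup n hϖ m hm := by
  intro i j
  have hconj : (1 - (diagGL d * g * (diagGL d)⁻¹).1) i j =
      d i * (1 - g.1) i j * (d j : F)⁻¹ := by
    rw [Matrix.sub_apply, Matrix.sub_apply, diagGL_conj_apply]
    obtain rfl | hij := eq_or_ne i j
    · field_simp
    · simp [Matrix.one_apply_ne hij]
  rw [hconj]
  obtain h0 | h0 := eq_or_ne ((1 - g.1) i j) 0
  · simp [h0]
  have hij : ‖(d i : F)‖ ≤ ‖(d j : F)‖ := by
    obtain rfl | hne := eq_or_ne i j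
    · rfl
    · exact hd i j (by simpa [Matrix.one_apply_ne hne] using h0)
  calc ‖d i * (1 - g.1) i j * (d j : F)⁻¹‖ = ‖(1 - g.1) i j‖ * (‖(d i : F)‖ / ‖(d j : F)‖) := by
        rw [norm_mul, norm_mul, norm_inv]
        ring
    _ ≤ ‖(1 - g.1) i j‖ :=
        mul_le_of_le_one_right (norm_nonneg _) (div_le_one_of_le₀ hij (norm_nonneg _))
    _ ≤ ‖(ϖ : F)‖ ^ m := hg i j

theorem exists_eq_mul_conj_mem_congruenceSubgroup {a b : Fin n → Fˣ}
    (ha : Antitone fun i => ‖(a i : F)‖) (hb : Antitone fun i => ‖(b i : F)‖) {k : GL (Fin n) F}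
    (hk : k ∈ congruenceSubgroup n hϖ m hm) :
    ∃ y z, k = y * z ∧ diagGL a * y * (diagGL a)⁻¹ ∈ congruenceSubgroup n hϖ m hm ∧
      (diagGL b)⁻¹ * z * diagGL b ∈ congruenceSubgroup n hϖ m hm := by
  obtain ⟨y, hy, z, hz, hyz, hlower, hupper⟩ :=
    exists_isLowerTriangular_mul_isUpperTriangular_of_mem_congruenceSubgroup hk
  refine ⟨y, z, hyz, diagGL_conj_mem_congruenceSubgroup hy fun i j hij => ha ?_, ?_⟩
  · exact not_lt.1 fun h => hij (hlower h)
  · have hinv := diagGL_conj_mem_congruenceSubgroup (d := b⁻¹) hz fun i j hij => ?_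
    · rwa [map_inv, inv_inv] at hinv
    · simpa using inv_anti₀ (by simp) (hb (not_lt.1 fun h => hij (hupper h)))

end Triangular

end MatrixGroups

section Torus

/-- The submonoid of dominant elements of the diagonal torus of `GL_n`: those whose entries have
decreasing absolute values. -/
def dominant (F : Type*) [NormedField F] (n : ℕ) : Submonoid (Fin n → Fˣ) where
  carrier := {d | Antitone fun i => ‖(d i : F)‖}
  one_mem' := antitone_const (c := ‖(1 : F)‖)
  mul_mem' {a b} ha hb i j hij := by
    simpa only [Pi.mul_apply, Units.val_mul, norm_mul] using
      mul_le_mul (ha hij) (hb hij) (norm_nonneg _) (norm_nonneg _)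

/-- `Fin.partialProd` as a homomorphism; it parametrizes the torus elements with first entry `1` by
the quotients of their consecutive entries. -/
def partialProdHom (M : Type*) [CommMonoid M] (l : ℕ) : (Fin l → M) →* (Fin (l + 1) → M) where
  toFun := Fin.partialProd
  map_one' := by
    ext j
    induction j using Fin.induction with
    | zero => simp
    | succ j ih => simpa [Fin.partialProd_succ] using ih
  map_mul' a b := by
    ext j
    induction j using Fin.induction with
    | zero => simp
    | succ j ih =>
      simp only [Pi.mul_apply, Fin.partialProd_succ] at ih ⊢
      rw [ih, mul_mul_mul_comm]

/-- The `i`-th fundamental coweight evaluated at `p`: the torus element `(1, …, 1, p, …, p)` with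
`i + 1` entries `1`. -/
def fundamentalCoweight {M : Type*} [CommMonoid M] {l : ℕ} (p : M) (i : Fin l) :
    Fin (l + 1) → M :=
  partialProdHom M l (Pi.mulSingle i p)

theorem prod_fundamentalCoweight_pow {M : Type*} [CommMonoid M] {l : ℕ} (p : M) (e : Fin l → ℕ) :
    ∏ i, fundamentalCoweight p i ^ e i = partialProdHom M l fun i => p ^ e i := by
  simp only [fundamentalCoweight, ← map_pow, ← map_prod, ← Pi.mulSingle_pow]
  rw [Finset.univ_prod_mulSingle]

theorem eq_const_mul_partialProdHom {G : Type*} [CommGroup G] {l : ℕ} (d : Fin (l + 1) → G) :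
    d = (fun _ => d 0) * partialProdHom G l fun i => (d i.castSucc)⁻¹ * d i.succ :=
  (Fin.partialProd_left_inv d).symm

variable {F : Type*} [NormedField F] {l : ℕ}

theorem partialProdHom_mem_dominant {t : Fin l → Fˣ} (ht : ∀ i, ‖(t i : F)‖ ≤ 1) :
    partialProdHom Fˣ l t ∈ dominant F (l + 1) := by
  refine Fin.antitone_iff_succ_le.2 fun i => ?_
  simpa only [partialProdHom, MonoidHom.coe_mk, OneHom.coe_mk, Fin.partialProd_succ, Units.val_mul,
    norm_mul] using mul_le_of_le_one_right (norm_nonneg _) (ht i)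

theorem norm_partialProdHom_eq_one {t : Fin l → Fˣ} (ht : ∀ i, ‖(t i : F)‖ = 1)
    (j : Fin (l + 1)) : ‖(partialProdHom Fˣ l t j : F)‖ = 1 := by
  induction j using Fin.induction with
  | zero => simp [partialProdHom]
  | succ j ih => simpa [partialProdHom, Fin.partialProd_succ, ht] using ih

theorem fundamentalCoweight_mem_dominant {p : Fˣ} (hp : ‖(p : F)‖ ≤ 1) (i : Fin l) :
    fundamentalCoweight p i ∈ dominant F (l + 1) :=
  partialProdHom_mem_dominant fun j => by
    obtain rfl | hij := eq_or_ne j i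
    · simpa using hp
    · simp [hij]

theorem exists_eq_const_mul_prod_fundamentalCoweight_mul {p : Fˣ}
    (hp : ∀ x : F, x ≠ 0 → ‖x‖ ≤ 1 → ∃ e : ℕ, ‖x‖ = ‖(p : F)‖ ^ e) {d : Fin (l + 1) → Fˣ}
    (hd : d ∈ dominant F (l + 1)) :
    ∃ (c : Fˣ) (e : Fin l → ℕ) (u : Fin (l + 1) → Fˣ), (∀ j, ‖(u j : F)‖ = 1) ∧
      d = (fun _ => c) * (∏ i, fundamentalCoweight p i ^ e i) * u := by
  have hratio (i : Fin l) :
      ∃ e : ℕ, ‖(((d i.castSucc)⁻¹ * d i.succ : Fˣ) : F)‖ = ‖(p : F)‖ ^ e := by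
    refine hp _ (Units.ne_zero _) ?_
    rw [Units.val_mul, Units.val_inv_eq_inv_val, norm_mul, norm_inv, ← div_eq_inv_mul]
    exact div_le_one_of_le₀ (hd Fin.castSucc_lt_succ.le) (norm_nonneg _)
  choose e he using hratio
  refine ⟨d 0, e, partialProdHom Fˣ l fun i => (p ^ e i)⁻¹ * ((d i.castSucc)⁻¹ * d i.succ),
    norm_partialProdHom_eq_one fun i => ?_, ?_⟩
  · rw [Units.val_mul, norm_mul, he, Units.val_inv_eq_inv_val, Units.val_pow_eq_pow_val, norm_inv,
      norm_pow]
    exact inv_mul_cancel₀ (pow_ne_zero _ (norm_ne_zero_iff.2 p.ne_zero))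
  · rw [prod_fundamentalCoweight_pow, mul_assoc, ← map_mul]
    simpa [Pi.mul_def] using eq_const_mul_partialProdHom d

end Torus

section Averaging

attribute [local instance] Subgroup.fintypeQuotientOfFiniteIndex

variable {k K V : Type*} [Field k] [Group K] [AddCommGroup V] [Module k V]
  (ρ : Representation k K V)

/-- Every vector has a finite orbit, expressed by a subgroup of finite index that fixes it. -/
def HasFiniteOrbits : Prop :=
  ∀ v, ∃ N : Subgroup K, N.FiniteIndex ∧ ∀ g ∈ N, ρ g v = v

/-- The average of the translates of a vector by representatives of `K ⧸ N`; it does not depend on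
the representatives if `N` fixes the vector. -/
noncomputable def cosetAverage (N : Subgroup K) [N.FiniteIndex] : V →ₗ[k] V :=
  (Fintype.card (K ⧸ N) : k)⁻¹ • ∑ q : K ⧸ N, ρ q.out

variable {ρ} {v : V}

theorem cosetAverage_apply {N : Subgroup K} [N.FiniteIndex] :
    cosetAverage ρ N v = (Fintype.card (K ⧸ N) : k)⁻¹ • ∑ q : K ⧸ N, ρ q.out v := by
  simp [cosetAverage]

theorem apply_out_mk {N : Subgroup K} (hv : ∀ g ∈ N, ρ g v = v) (g : K) :
    ρ (QuotientGroup.mk g : K ⧸ N).out v = ρ g v := by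
  obtain ⟨h, hh⟩ := QuotientGroup.mk_out_eq_mul N g
  rw [hh, map_mul, Module.End.mul_apply, hv h h.2]

theorem cosetAverage_mem_invariants {N : Subgroup K} [N.FiniteIndex] (hv : ∀ g ∈ N, ρ g v = v) :
    cosetAverage ρ N v ∈ ρ.invariants := by
  intro g
  rw [cosetAverage_apply, map_smul, map_sum]
  congr 1
  refine Fintype.sum_equiv (MulAction.toPerm g) _ _ fun q => ?_
  induction q using QuotientGroup.induction_on with
  | H h =>
    rw [MulAction.toPerm_apply, MulAction.Quotient.smul_mk, apply_out_mk hv, apply_out_mk hv,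
      smul_eq_mul, map_mul, Module.End.mul_apply]

theorem cosetAverage_apply_of_normal {N : Subgroup K} [N.FiniteIndex] [N.Normal]
    (hv : ∀ g ∈ N, ρ g v = v) (g : K) : cosetAverage ρ N (ρ g v) = cosetAverage ρ N v := by
  rw [cosetAverage_apply, cosetAverage_apply]
  congr 1
  refine Fintype.sum_equiv (Equiv.mulRight (QuotientGroup.mk g : K ⧸ N)) _ _ fun q => ?_
  rw [← Module.End.mul_apply, ← map_mul, ← apply_out_mk hv, QuotientGroup.mk_mul,
    QuotientGroup.out_eq', Equiv.coe_mulRight]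

theorem HasFiniteOrbits.exists_cosetAverage_eq_zero (hρ : HasFiniteOrbits ρ)
    (hv : v ∈ Representation.Coinvariants.ker ρ) :
    ∃ N : Subgroup K, ∃ _ : N.FiniteIndex, cosetAverage ρ N v = 0 := by
  suffices hsmall : ∃ N₀ : Subgroup K, N₀.FiniteIndex ∧ N₀.Normal ∧
      ∀ N ≤ N₀, ∀ [N.FiniteIndex] [N.Normal], cosetAverage ρ N v = 0 by
    obtain ⟨N₀, hfin, hnormal, hN₀⟩ := hsmall
    exact ⟨N₀, hfin, hN₀ N₀ le_rfl⟩
  induction hv using Submodule.span_induction with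
  | mem v hv =>
    obtain ⟨⟨g, w⟩, rfl⟩ := hv
    obtain ⟨N₀, hfin, hw⟩ := hρ w
    refine ⟨N₀.normalCore, inferInstance, inferInstance, fun N hN _ _ => ?_⟩
    rw [map_sub, sub_eq_zero]
    exact cosetAverage_apply_of_normal (fun h hh => hw h (N₀.normalCore_le (hN hh))) g
  | zero => exact ⟨⊤, inferInstance, inferInstance, fun N _ _ _ => map_zero _⟩
  | add v w _ _ ihv ihw =>
    obtain ⟨N₁, _, _, hN₁⟩ := ihv
    obtain ⟨N₂, _, _, hN₂⟩ := ihw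
    refine ⟨N₁ ⊓ N₂, inferInstance, inferInstance, fun N hN _ _ => ?_⟩
    rw [map_add, hN₁ N (hN.trans inf_le_left), hN₂ N (hN.trans inf_le_right), add_zero]
  | smul c v _ ih =>
    obtain ⟨N₀, hfin, hnormal, hN₀⟩ := ih
    exact ⟨N₀, hfin, hnormal, fun N hN _ _ => by rw [map_smul, hN₀ N hN, smul_zero]⟩

variable [CharZero k]

theorem map_cosetAverage {W : Type*} [AddCommGroup W] [Module k W] {N : Subgroup K}
    [N.FiniteIndex] (f : V →ₗ[k] W) (hf : ∀ g, f (ρ g v) = f v) :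
    f (cosetAverage ρ N v) = f v := by
  rw [cosetAverage_apply, map_smul, map_sum, Finset.sum_congr rfl fun q _ => hf q.out,
    Finset.sum_const, Finset.card_univ, ← Nat.cast_smul_eq_nsmul k, smul_smul,
    inv_mul_cancel₀ (Nat.cast_ne_zero.2 Fintype.card_ne_zero), one_smul]

theorem sub_cosetAverage_mem_ker {N : Subgroup K} [N.FiniteIndex] :
    v - cosetAverage ρ N v ∈ Representation.Coinvariants.ker ρ := by
  have hmk := map_cosetAverage (N := N) (Representation.Coinvariants.mk ρ) (v := v) fun g =>
    (Representation.Coinvariants.mk_eq_iff ρ).2 (Representation.Coinvariants.sub_mem_ker g v)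
  exact (Representation.Coinvariants.mk_eq_iff ρ).1 hmk.symm

theorem HasFiniteOrbits.isCompl_invariants_ker (hρ : HasFiniteOrbits ρ) :
    IsCompl ρ.invariants (Representation.Coinvariants.ker ρ) := by
  refine ⟨Submodule.disjoint_def.2 fun v hinv hker => ?_,
    Submodule.codisjoint_iff_exists_add_eq.2 fun v => ?_⟩
  · obtain ⟨N, _, hN⟩ := hρ.exists_cosetAverage_eq_zero hker
    rw [← hN]
    exact (map_cosetAverage LinearMap.id hinv).symm
  · obtain ⟨N, _, hv⟩ := hρ v
    exact ⟨_, _, cosetAverage_mem_invariants hv, sub_cosetAverage_mem_ker, add_sub_cancel _ v⟩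

/-- The projection onto the invariants along the span of the differences `ρ g v - v`, that is,
averaging over `K`. -/
noncomputable def HasFiniteOrbits.average (hρ : HasFiniteOrbits ρ) : V →ₗ[k] ρ.invariants :=
  Submodule.projectionOnto _ _ hρ.isCompl_invariants_ker

theorem HasFiniteOrbits.average_coe (hρ : HasFiniteOrbits ρ) (v : ρ.invariants) :
    hρ.average v = v :=
  Submodule.projectionOnto_apply_left _ v

theorem HasFiniteOrbits.average_apply (hρ : HasFiniteOrbits ρ) (g : K) (v : V) :
    hρ.average (ρ g v) = hρ.average v := by
  rw [← sub_eq_zero, ← map_sub]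
  exact (Submodule.projectionOnto_apply_eq_zero_iff _).2
    (Representation.Coinvariants.sub_mem_ker g v)

theorem HasFiniteOrbits.coe_average_eq_cosetAverage (hρ : HasFiniteOrbits ρ) {N : Subgroup K}
    [N.FiniteIndex] (hv : ∀ g ∈ N, ρ g v = v) : (hρ.average v : V) = cosetAverage ρ N v := by
  rw [← map_cosetAverage (N := N) hρ.average fun g => hρ.average_apply g v]
  exact congrArg Subtype.val (hρ.average_coe ⟨_, cosetAverage_mem_invariants hv⟩)

theorem HasFiniteOrbits.map_average (hρ : HasFiniteOrbits ρ) {W : Type*} [AddCommGroup W]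
    [Module k W] (f : V →ₗ[k] W) (hf : ∀ g, f (ρ g v) = f v) : f (hρ.average v) = f v := by
  obtain ⟨N, _, hv⟩ := hρ v
  rw [hρ.coe_average_eq_cosetAverage hv, map_cosetAverage f hf]

end Averaging

section Hecke

section Operators

variable {G V : Type*} [Group G] [AddCommGroup V] [Module ℂ V] {π : Representation ℂ G V}
  {K : Subgroup G} (h : HasFiniteOrbits (π.comp K.subtype))

theorem apply_eq_self {g : G} (hg : g ∈ K) (v : fixedVectors π K) : π g v = v :=
  v.2 ⟨g, hg⟩

/-- The Hecke operator of the double coset `K g K` on `V^K`, normalized to be `v ↦ e (π g v)`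
where `e` is the averaging projection onto `V^K`. -/
noncomputable def hecke (g : G) : Module.End ℂ (fixedVectors π K) :=
  h.average ∘ₗ π g ∘ₗ (fixedVectors π K).subtype

theorem hecke_apply (g : G) (v : fixedVectors π K) : hecke h g v = h.average (π g v) :=
  rfl

theorem average_apply_of_mem {k : G} (hk : k ∈ K) (v : V) : h.average (π k v) = h.average v :=
  h.average_apply ⟨k, hk⟩ v

theorem hecke_one : hecke h 1 = 1 := by
  ext v
  rw [hecke_apply, map_one, Module.End.one_apply]
  exact congrArg Subtype.val (h.average_coe v)

theorem hecke_mul_of_mem (a : G) {k : G} (hk : k ∈ K) : hecke h (a * k) = hecke h a := by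
  ext v
  rw [hecke_apply, hecke_apply, map_mul, Module.End.mul_apply, apply_eq_self hk]

theorem hecke_mul_of_factorization {a b : G}
    (hab : ∀ k ∈ K, ∃ y z, k = y * z ∧ a * y * a⁻¹ ∈ K ∧ b⁻¹ * z * b ∈ K) :
    hecke h (a * b) = hecke h a * hecke h b := by
  ext v
  have hK : ∀ k : K, h.average (π a (π k (π b v))) = h.average (π a (π b v)) := fun k => by
    obtain ⟨y, z, hyz, hy, hz⟩ := hab k k.2
    calc h.average (π a (π k (π b v)))
        = h.average (π (a * y * a⁻¹) (π a (π b (π (b⁻¹ * z * b) v)))) := by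
          simp only [hyz, ← Module.End.mul_apply, ← map_mul]
          congr 3
          group
      _ = h.average (π a (π b v)) := by rw [average_apply_of_mem h hy, apply_eq_self hz]
  rw [hecke_apply, map_mul]
  exact congrArg Subtype.val (h.map_average (h.average ∘ₗ π a) hK).symm

theorem hecke_mul_of_mem_normalizer_left {a : G} (ha : a ∈ Subgroup.normalizer (K : Set G))
    (b : G) : hecke h (a * b) = hecke h a * hecke h b :=
  hecke_mul_of_factorization h fun k hk =>
    ⟨k, 1, (mul_one k).symm, (ha k).1 hk, by simp [one_mem]⟩

theorem hecke_mul_of_mem_normalizer_right (a : G) {b : G}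
    (hb : b ∈ Subgroup.normalizer (K : Set G)) : hecke h (a * b) = hecke h a * hecke h b :=
  hecke_mul_of_factorization h fun k hk =>
    ⟨1, k, (one_mul k).symm, by simp [one_mem], by simpa using (inv_mem hb k).1 hk⟩

end Operators

section Irreducible

open Subgroup.Commensurable (commensurator)
open scoped Pointwise

attribute [local instance] Subgroup.fintypeQuotientOfFiniteIndex

theorem commensurator_eq_top_of_isOpen_of_isCompact {G : Type*} [Group G] [TopologicalSpace G]
    [IsTopologicalGroup G] {K : Subgroup G} (hopen : IsOpen (K : Set G))
    (hcompact : IsCompact (K : Set G)) : commensurator K = ⊤ := by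
  refine eq_top_iff.2 fun g _ => ?_
  let conj : G ≃ₜ G := (Homeomorph.mulLeft g).trans (Homeomorph.mulRight g⁻¹)
  have hconj : ((ConjAct.toConjAct g • K : Subgroup G) : Set G) = conj '' K := rfl
  have hopen' : IsOpen ((ConjAct.toConjAct g • K : Subgroup G) : Set G) :=
    hconj ▸ conj.isOpenMap _ hopen
  have hcompact' : IsCompact ((ConjAct.toConjAct g • K : Subgroup G) : Set G) :=
    hconj ▸ hcompact.image conj.continuous
  exact ⟨relIndex_ne_zero_of_isOpen_of_isCompact hopen' hcompact,
    relIndex_ne_zero_of_isOpen_of_isCompact hopen hcompact'⟩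

theorem span_range_apply_eq_top {k G V : Type*} [Field k] [Monoid G] [AddCommGroup V]
    [Module k V] {π : Representation k G V} (hirr : π.IsIrreducible) {v : V} (hv : v ≠ 0) :
    Submodule.span k (Set.range fun g => π g v) = ⊤ := by
  let U : Subrepresentation π :=
    { toSubmodule := Submodule.span k (Set.range fun g => π g v)
      apply_mem_toSubmodule g u hu := by
        have hle : Submodule.span k (Set.range fun g => π g v) ≤
            (Submodule.span k (Set.range fun g => π g v)).comap (π g) := by
          refine Submodule.span_le.2 ?_
          rintro _ ⟨a, rfl⟩
          exact Submodule.subset_span ⟨g * a, by simp⟩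
        exact hle hu }
  have hvU : v ∈ U.toSubmodule := Submodule.subset_span ⟨1, by simp⟩
  have hU : U = ⊤ := (hirr.eq_bot_or_eq_top U).resolve_left fun hbot => hv (by
    rw [hbot] at hvU
    exact (Submodule.mem_bot k).1 hvU)
  exact congrArg Subrepresentation.toSubmodule hU

variable {G V : Type*} [Group G] [AddCommGroup V] [Module ℂ V] {π : Representation ℂ G V}
  {K : Subgroup G}

theorem exists_finiteIndex_forall_apply_apply_eq (hcomm : commensurator K = ⊤) (g : G) :
    ∃ N : Subgroup K, N.FiniteIndex ∧
      ∀ n ∈ N, ∀ v : fixedVectors π K, π.comp K.subtype n (π g v) = π g v := by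
  have hg : g ∈ commensurator K := hcomm ▸ Subgroup.mem_top g
  refine ⟨(ConjAct.toConjAct g • K).subgroupOf K, ⟨hg.1⟩, fun n hn v => ?_⟩
  have hgn : g⁻¹ * n * g ∈ K := by
    simpa [Subgroup.mem_subgroupOf, Subgroup.mem_pointwise_smul_iff_inv_smul_mem,
      ConjAct.smul_def] using hn
  calc π n (π g v) = π g (π (g⁻¹ * n * g) v) := by
        simp only [← Module.End.mul_apply, ← map_mul, mul_assoc, mul_inv_cancel_left]
    _ = π g v := by rw [apply_eq_self hgn]

theorem hasFiniteOrbits_of_isIrreducible (hirr : π.IsIrreducible) (hcomm : commensurator K = ⊤)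
    {v : fixedVectors π K} (hv : v ≠ 0) : HasFiniteOrbits (π.comp K.subtype) := by
  have hv' : (v : V) ≠ 0 := fun h => hv (Subtype.ext h)
  intro u
  have hu : u ∈ Submodule.span ℂ (Set.range fun g => π g v) :=
    span_range_apply_eq_top hirr hv' ▸ Submodule.mem_top
  induction hu using Submodule.span_induction with
  | mem u hu =>
    obtain ⟨g, rfl⟩ := hu
    obtain ⟨N, hfin, hN⟩ := exists_finiteIndex_forall_apply_apply_eq (π := π) hcomm g
    exact ⟨N, hfin, fun n hn => hN n hn v⟩
  | zero => exact ⟨⊤, inferInstance, fun n _ => map_zero _⟩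
  | add u w _ _ ihu ihw =>
    obtain ⟨N₁, _, hN₁⟩ := ihu
    obtain ⟨N₂, _, hN₂⟩ := ihw
    exact ⟨N₁ ⊓ N₂, inferInstance, fun n hn => by rw [map_add, hN₁ n hn.1, hN₂ n hn.2]⟩
  | smul c u _ ih =>
    obtain ⟨N, hfin, hN⟩ := ih
    exact ⟨N, hfin, fun n hn => by rw [map_smul, hN n hn]⟩

variable (h : HasFiniteOrbits (π.comp K.subtype))

theorem hecke_mul_mem_span (hcomm : commensurator K = ⊤) (a b : G) :
    hecke h a * hecke h b ∈ Submodule.span ℂ (Set.range (hecke h)) := by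
  obtain ⟨N, hfin, hN⟩ := exists_finiteIndex_forall_apply_apply_eq (π := π) hcomm b
  have hsum : hecke h a * hecke h b =
      (Fintype.card (K ⧸ N) : ℂ)⁻¹ • ∑ q : K ⧸ N, hecke h (a * (q.out : K) * b) := by
    refine LinearMap.ext fun v => ?_
    rw [Module.End.mul_apply, hecke_apply, hecke_apply,
      h.coe_average_eq_cosetAverage fun n hn => hN n hn v, cosetAverage_apply]
    simp only [map_smul, map_sum, map_mul, LinearMap.smul_apply, LinearMap.sum_apply,
      hecke_apply, Module.End.mul_apply]
    rfl
  rw [hsum]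
  exact Submodule.smul_mem _ _ (Submodule.sum_mem _ fun q _ => Submodule.subset_span ⟨_, rfl⟩)

/-- The Hecke algebra: the algebra of operators on `V^K` spanned by the Hecke operators. -/
noncomputable def heckeAlgebra (hcomm : commensurator K = ⊤) :
    Subalgebra ℂ (Module.End ℂ (fixedVectors π K)) :=
  (Submodule.span ℂ (Set.range (hecke h))).toSubalgebra
    (Submodule.subset_span ⟨1, hecke_one h⟩) fun x y hx hy => by
      have hxy := Submodule.mul_mem_mul hx hy
      rw [Submodule.span_mul_span] at hxy
      refine Submodule.span_le.2 ?_ hxy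
      rintro _ ⟨_, ⟨a, rfl⟩, _, ⟨b, rfl⟩, rfl⟩
      exact hecke_mul_mem_span h hcomm a b

theorem isSimpleModule_heckeAlgebra (hirr : π.IsIrreducible) (hcomm : commensurator K = ⊤)
    [Nontrivial (fixedVectors π K)] :
    IsSimpleModule (heckeAlgebra h hcomm) (fixedVectors π K) := by
  refine isSimpleModule_iff_toSpanSingleton_surjective.2 ⟨inferInstance, fun v hv w => ?_⟩
  have hv' : (v : V) ≠ 0 := fun h0 => hv (Subtype.ext h0)
  have hw : (w : V) ∈ Submodule.span ℂ (Set.range fun g => π g v) :=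
    span_range_apply_eq_top hirr hv' ▸ Submodule.mem_top
  obtain ⟨c, hc⟩ := Finsupp.mem_span_range_iff_exists_finsupp.1 hw
  refine ⟨⟨c.sum fun g a => a • hecke h g, Submodule.sum_mem _ fun g _ =>
    Submodule.smul_mem _ _ (Submodule.subset_span ⟨g, rfl⟩)⟩, ?_⟩
  change (c.sum fun g a => a • hecke h g) v = w
  have hsum : (c.sum fun g a => a • hecke h g) v = h.average (c.sum fun g a => a • π g v) := by
    simp only [Finsupp.sum, LinearMap.sum_apply, LinearMap.smul_apply, map_sum, map_smul,
      hecke_apply]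
    rfl
  rw [hsum, hc]
  exact h.average_coe w

theorem span_range_hecke_eq_top (hirr : π.IsIrreducible) (hcomm : commensurator K = ⊤)
    [FiniteDimensional ℂ (fixedVectors π K)] :
    Submodule.span ℂ (Set.range (hecke h)) = ⊤ := by
  rcases subsingleton_or_nontrivial (fixedVectors π K) with _ | _
  · exact Subsingleton.elim _ _
  have := isSimpleModule_heckeAlgebra h hirr hcomm
  exact congrArg Subalgebra.toSubmodule
    (subalgebra_eq_top_of_isSimpleModule (heckeAlgebra h hcomm))

theorem exists_hecke_eq_smul_one (hirr : π.IsIrreducible) (hcomm : commensurator K = ⊤)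
    [FiniteDimensional ℂ (fixedVectors π K)] {z : G} (hz : z ∈ Subgroup.center G) :
    ∃ c : ℂ, hecke h z = c • 1 := by
  have hzK := Subgroup.center_le_normalizer (K : Set G) hz
  have hcenter : hecke h z ∈ Subalgebra.center ℂ (Module.End ℂ (fixedVectors π K)) := by
    refine Subalgebra.mem_center_iff.2 fun f => ?_
    have hf : f ∈ Submodule.span ℂ (Set.range (hecke h)) :=
      span_range_hecke_eq_top h hirr hcomm ▸ Submodule.mem_top
    induction hf using Submodule.span_induction with
    | mem f hf =>
      obtain ⟨g, rfl⟩ := hf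
      rw [← hecke_mul_of_mem_normalizer_left h hzK, ← hecke_mul_of_mem_normalizer_right h _ hzK,
        Subgroup.mem_center_iff.1 hz]
    | zero => rw [zero_mul, mul_zero]
    | add f g _ _ hf hg => rw [add_mul, mul_add, hf, hg]
    | smul c f _ hf => rw [smul_mul_assoc, mul_smul_comm, hf]
  rw [Algebra.IsCentral.center_eq_bot, Algebra.mem_bot] at hcenter
  obtain ⟨c, hc⟩ := hcenter
  exact ⟨c, by rw [← hc, Algebra.algebraMap_eq_smul_one]⟩

theorem finrank_fixedVectors_sq_le [FiniteDimensional ℂ (fixedVectors π K)]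
    (hirr : π.IsIrreducible) (hcomm : commensurator K = ⊤) {K₀ : Subgroup G}
    (hnormalizer : K₀ ≤ Subgroup.normalizer (K : Set G)) (hindex : K.relIndex K₀ ≠ 0)
    {C : Submodule ℂ (Module.End ℂ (fixedVectors π K))}
    (hC : ∀ g, ∃ P ∈ K₀, ∃ d, ∃ Q ∈ K₀, g = P * d * Q ∧ hecke h d ∈ C) :
    Module.finrank ℂ (fixedVectors π K) ^ 2 ≤ K.relIndex K₀ ^ 2 * Module.finrank ℂ C := by
  have : (K.subgroupOf K₀).FiniteIndex := ⟨hindex⟩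
  let R := K₀ ⧸ K.subgroupOf K₀
  have hrep : ∀ P : K₀, hecke h P = hecke h (QuotientGroup.mk P : R).out := fun P => by
    obtain ⟨k, hk⟩ := QuotientGroup.mk_out_eq_mul (K.subgroupOf K₀) P
    rw [hk]
    exact (hecke_mul_of_mem h _ k.2).symm
  let S : R × R → Submodule ℂ (Module.End ℂ (fixedVectors π K)) := fun q =>
    C.map (LinearMap.mulLeft ℂ (hecke h q.1.out) ∘ₗ LinearMap.mulRight ℂ (hecke h q.2.out))
  have hS : ⨆ q, S q = ⊤ := by
    rw [eq_top_iff, ← span_range_hecke_eq_top h hirr hcomm, Submodule.span_le]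
    rintro _ ⟨g, rfl⟩
    obtain ⟨P, hP, d, Q, hQ, rfl, hd⟩ := hC g
    refine Submodule.mem_iSup_of_mem
      ((QuotientGroup.mk ⟨P, hP⟩, QuotientGroup.mk ⟨Q, hQ⟩) : R × R) ⟨_, hd, ?_⟩
    rw [hecke_mul_of_mem_normalizer_right h _ (hnormalizer hQ),
      hecke_mul_of_mem_normalizer_left h (hnormalizer hP), hrep ⟨P, hP⟩, hrep ⟨Q, hQ⟩, mul_assoc]
    rfl
  calc Module.finrank ℂ (fixedVectors π K) ^ 2
      = Module.finrank ℂ ↥(⨆ q, S q) := by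
        rw [hS, finrank_top, Module.finrank_linearMap, sq]
    _ ≤ ∑ q, Module.finrank ℂ (S q) := finrank_iSup_le_sum S
    _ ≤ ∑ _q : R × R, Module.finrank ℂ C :=
        Finset.sum_le_sum fun q _ => Submodule.finrank_map_le _ _
    _ = K.relIndex K₀ ^ 2 * Module.finrank ℂ C := by
        rw [Finset.sum_const, Finset.card_univ, Fintype.card_prod, smul_eq_mul, sq,
          ← Nat.card_eq_fintype_card]
        rfl

end Irreducible

end Hecke

section Bound

theorem pow_self_lt_factorial_sq {n : ℕ} (hn : 3 ≤ n) : n ^ n < n.factorial ^ 2 := by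
  have hfactorial : n.factorial ^ 2 = ∏ i ∈ Finset.range n, (i + 1) * (n - i) := by
    rw [Finset.prod_mul_distrib, Finset.prod_range_add_one_eq_factorial, sq]
    congr 1
    rw [← Finset.prod_range_add_one_eq_factorial, ← Finset.prod_range_reflect]
    refine Finset.prod_congr rfl fun i hi => ?_
    have := Finset.mem_range.1 hi
    omega
  have hpow : n ^ n = ∏ _i ∈ Finset.range n, n := by simp
  rw [hfactorial, hpow]
  refine Finset.prod_lt_prod (fun i _ => by omega) (fun i hi => ?_)
    ⟨1, Finset.mem_range.2 (by omega), by omega⟩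
  obtain ⟨c, rfl⟩ := Nat.exists_eq_add_of_lt (Finset.mem_range.1 hi)
  rw [show i + c + 1 - i = c + 1 by omega]
  nlinarith [Nat.zero_le (i * c)]

theorem natCast_rpow_half_sq (n : ℕ) : ((n : ℝ) ^ ((n : ℝ) / 2)) ^ 2 = (n : ℝ) ^ n := by
  rw [← Real.rpow_natCast, ← Real.rpow_mul (Nat.cast_nonneg n)]
  norm_num

theorem pow_mul_rpow_lt_pow_two_pow {n N : ℕ} (hn : 3 ≤ n) (hN : n.factorial ≤ N) :
    (N : ℝ) ^ n * (n : ℝ) ^ ((n : ℝ) / 2) < (N : ℝ) ^ (2 ^ (n - 1)) := by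
  have hrpow : (n : ℝ) ^ ((n : ℝ) / 2) < N := by
    refine lt_of_pow_lt_pow_left₀ 2 (Nat.cast_nonneg N) ?_
    rw [natCast_rpow_half_sq]
    exact_mod_cast (pow_self_lt_factorial_sq hn).trans_le (Nat.pow_le_pow_left hN 2)
  have hN1 : (1 : ℝ) ≤ N := by exact_mod_cast n.factorial_pos.trans_le hN
  have hexp : n + 1 ≤ 2 ^ (n - 1) := by
    obtain ⟨k, rfl⟩ := Nat.exists_eq_add_of_le hn
    rw [show 3 + k - 1 = k + 2 by omega, pow_add]
    have := Nat.lt_two_pow_self (n := k)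
    omega
  calc (N : ℝ) ^ n * (n : ℝ) ^ ((n : ℝ) / 2) < (N : ℝ) ^ n * N := by gcongr
    _ = (N : ℝ) ^ (n + 1) := (pow_succ _ _).symm
    _ ≤ (N : ℝ) ^ (2 ^ (n - 1)) := pow_le_pow_right₀ hN1 hexp

theorem le_pow_mul_rpow_of_sq_le {D N A l : ℕ} (hD : D ^ 2 ≤ N ^ 2 * A)
    (hA : A ^ (l + 1) ≤ (l + 1) ^ (l + 1) * (D ^ 2) ^ l) :
    (D : ℝ) ≤ (N : ℝ) ^ (l + 1) * ((l + 1 : ℕ) : ℝ) ^ (((l + 1 : ℕ) : ℝ) / 2) := by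
  rcases Nat.eq_zero_or_pos D with rfl | hD0
  · rw [Nat.cast_zero]
    positivity
  have hsq : D ^ 2 ≤ (N ^ (l + 1)) ^ 2 * (l + 1) ^ (l + 1) := by
    refine Nat.le_of_mul_le_mul_right ?_ (pow_pos (pow_pos hD0 2) l)
    calc D ^ 2 * (D ^ 2) ^ l = (D ^ 2) ^ (l + 1) := (pow_succ' _ _).symm
      _ ≤ (N ^ 2 * A) ^ (l + 1) := Nat.pow_le_pow_left hD _
      _ = (N ^ (l + 1)) ^ 2 * A ^ (l + 1) := by rw [mul_pow, pow_right_comm]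
      _ ≤ (N ^ (l + 1)) ^ 2 * ((l + 1) ^ (l + 1) * (D ^ 2) ^ l) := Nat.mul_le_mul_left _ hA
      _ = (N ^ (l + 1)) ^ 2 * (l + 1) ^ (l + 1) * (D ^ 2) ^ l := (mul_assoc _ _ _).symm
  refine (sq_le_sq₀ (Nat.cast_nonneg D) (by positivity)).1 ?_
  rw [mul_pow, natCast_rpow_half_sq]
  exact_mod_cast hsq

variable {F : Type*} [NontriviallyNormedField F] [IsUltrametricDist F] {ϖ : integers F}
  {hϖ : IsUniformizer ϖ} {m : ℕ} {hm : 1 ≤ m} {V : Type*} [AddCommGroup V] [Module ℂ V]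

section Dominant

variable {n : ℕ}

theorem commensurator_congruenceSubgroup [LocallyCompactSpace F] :
    Subgroup.Commensurable.commensurator (congruenceSubgroup n hϖ m hm) = ⊤ :=
  commensurator_eq_top_of_isOpen_of_isCompact (isOpen_congruenceSubgroup hϖ hm)
    (isCompact_congruenceSubgroup hϖ hm)

variable {π : Representation ℂ (GL (Fin n) F) V}
  (h : HasFiniteOrbits (π.comp (congruenceSubgroup n hϖ m hm).subtype))

/-- The Hecke operators of the dominant torus elements, which multiply like the torus elements. -/
noncomputable def heckeDominant :
    dominant F n →* Module.End ℂ (fixedVectors π (congruenceSubgroup n hϖ m hm)) where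
  toFun d := hecke h (diagGL d)
  map_one' := by rw [Submonoid.coe_one, map_one, hecke_one]
  map_mul' a b := by
    rw [Submonoid.coe_mul, map_mul]
    exact hecke_mul_of_factorization h fun k hk =>
      exists_eq_mul_conj_mem_congruenceSubgroup a.2 b.2 hk

theorem commute_heckeDominant (a b : dominant F n) :
    Commute (heckeDominant h a) (heckeDominant h b) :=
  (Commute.all a b).map (heckeDominant h)

end Dominant

variable {l : ℕ} {π : Representation ℂ (GL (Fin (l + 1)) F) V}
  (h : HasFiniteOrbits (π.comp (congruenceSubgroup (l + 1) hϖ m hm).subtype))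

/-- The algebra generated by the Hecke operators of the fundamental coweights evaluated at `p`. -/
noncomputable def coweightAlgebra (p : Fˣ) :
    Subalgebra ℂ (Module.End ℂ (fixedVectors π (congruenceSubgroup (l + 1) hϖ m hm))) :=
  Algebra.adjoin ℂ (Set.range fun i : Fin l => hecke h (diagGL (fundamentalCoweight p i)))

theorem hecke_prod_fundamentalCoweight_mem_coweightAlgebra {p : Fˣ} (hp : ‖(p : F)‖ ≤ 1)
    (e : Fin l → ℕ) :
    hecke h (diagGL (∏ i, fundamentalCoweight p i ^ e i)) ∈ coweightAlgebra h p := by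
  let ω (i : Fin l) : dominant F (l + 1) :=
    ⟨fundamentalCoweight p i, fundamentalCoweight_mem_dominant hp i⟩
  have hprod : hecke h (diagGL (∏ i, fundamentalCoweight p i ^ e i)) =
      heckeDominant h (∏ i, ω i ^ e i) := by
    simp [heckeDominant, ω]
  have hω (i : Fin l) : ω i ∈ (coweightAlgebra h p).toSubmonoid.comap (heckeDominant h) :=
    Algebra.subset_adjoin ⟨i, rfl⟩
  have hmem : ∏ i, ω i ^ e i ∈ (coweightAlgebra h p).toSubmonoid.comap (heckeDominant h) :=
    prod_mem fun i _ => pow_mem (hω i) _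
  rw [hprod]
  exact hmem

theorem finrank_coweightAlgebra_pow_le
    [FiniteDimensional ℂ (fixedVectors π (congruenceSubgroup (l + 1) hϖ m hm))] {p : Fˣ}
    (hp : ‖(p : F)‖ ≤ 1) :
    Module.finrank ℂ (coweightAlgebra h p) ^ (l + 1) ≤ (l + 1) ^ (l + 1) *
      (Module.finrank ℂ (fixedVectors π (congruenceSubgroup (l + 1) hϖ m hm)) ^ 2) ^ l := by
  have hcommute (i j : Fin l) := commute_heckeDominant h
    ⟨_, fundamentalCoweight_mem_dominant hp i⟩ ⟨_, fundamentalCoweight_mem_dominant hp j⟩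
  have hbound := finrank_adjoin_range_pow_le hcommute
  rw [Fintype.card_fin] at hbound
  exact hbound

variable [LocallyCompactSpace F]

theorem exists_eq_mul_mul_hecke_mem_coweightAlgebra
    [FiniteDimensional ℂ (fixedVectors π (congruenceSubgroup (l + 1) hϖ m hm))]
    (hirr : π.IsIrreducible) {p : Fˣ} (hp : ‖(p : F)‖ = ‖(ϖ : F)‖) (g : GL (Fin (l + 1)) F) :
    ∃ P ∈ integralGL F (l + 1), ∃ d, ∃ Q ∈ integralGL F (l + 1),
      g = P * d * Q ∧ hecke h d ∈ coweightAlgebra h p := by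
  obtain ⟨P, hP, Q, hQ, d, hd, rfl⟩ := exists_cartan_decomposition g
  obtain ⟨c, e, u, hu, rfl⟩ := exists_eq_const_mul_prod_fundamentalCoweight_mul
    (fun x hx0 hx1 => hp ▸ hϖ.exists_norm_eq_pow hx0 hx1) hd
  have hz : diagGL (fun _ => c) ∈ Subgroup.center (GL (Fin (l + 1)) F) := diagGL_const_mem_center c
  obtain ⟨a, ha⟩ := exists_hecke_eq_smul_one h hirr commensurator_congruenceSubgroup hz
  refine ⟨P, hP, diagGL (fun _ => c) * diagGL (∏ i, fundamentalCoweight p i ^ e i), diagGL u * Q,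
    mul_mem (diagGL_mem_integralGL hu) hQ, by simp only [map_mul, mul_assoc], ?_⟩
  rw [hecke_mul_of_mem_normalizer_left h (Subgroup.center_le_normalizer _ hz), ha, smul_one_mul]
  exact Subalgebra.smul_mem _
    (hecke_prod_fundamentalCoweight_mem_coweightAlgebra h (hp.trans_le hϖ.norm_lt_one.le) e) a

theorem finrank_fixedVectors_congruenceSubgroup_le
    [FiniteDimensional ℂ (fixedVectors π (congruenceSubgroup (l + 1) hϖ m hm))]
    (hirr : π.IsIrreducible) :
    (Module.finrank ℂ (fixedVectors π (congruenceSubgroup (l + 1) hϖ m hm)) : ℝ) ≤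
      ((congruenceSubgroup (l + 1) hϖ m hm).relIndex (integralGL F (l + 1)) : ℝ) ^ (l + 1) *
        ((l + 1 : ℕ) : ℝ) ^ (((l + 1 : ℕ) : ℝ) / 2) := by
  rcases subsingleton_or_nontrivial (fixedVectors π (congruenceSubgroup (l + 1) hϖ m hm)) with _ | _
  · rw [Module.finrank_zero_of_subsingleton, Nat.cast_zero]
    positivity
  obtain ⟨v, hv⟩ := exists_ne (0 : fixedVectors π (congruenceSubgroup (l + 1) hϖ m hm))
  have h := hasFiniteOrbits_of_isIrreducible hirr commensurator_congruenceSubgroup hv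
  let p : Fˣ := Units.mk0 (ϖ : F) (norm_pos_iff.1 hϖ.norm_pos)
  exact le_pow_mul_rpow_of_sq_le
    (finrank_fixedVectors_sq_le h hirr commensurator_congruenceSubgroup
      (integralGL_le_normalizer_congruenceSubgroup hϖ hm)
      (relIndex_ne_zero_of_isOpen_of_isCompact (isOpen_congruenceSubgroup hϖ hm)
        isCompact_integralGL)
      (C := (coweightAlgebra h p).toSubmodule)
      (exists_eq_mul_mul_hecke_mem_coweightAlgebra h hirr rfl))
    (finrank_coweightAlgebra_pow_le h (p := p) hϖ.norm_lt_one.le)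

end Bound

end UniformAdmissibility

theorem mainTheorem4_general {F : Type*} [NontriviallyNormedField F] [IsUltrametricDist F]
    [LocallyCompactSpace F] (n : ℕ) (hn : 1 ≤ n)
    (ϖ : UniformAdmissibility.integers F) (hϖ : UniformAdmissibility.IsUniformizer ϖ)
    (m : ℕ) (hm : 1 ≤ m)
    {V : Type*} [AddCommGroup V] [Module ℂ V] (π : Representation ℂ (GL (Fin n) F) V)
    (hirr : π.IsIrreducible)
    [FiniteDimensional ℂ (UniformAdmissibility.fixedVectors π
      (UniformAdmissibility.congruenceSubgroup n hϖ m hm))] :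
    (Module.finrank ℂ (UniformAdmissibility.fixedVectors π
        (UniformAdmissibility.congruenceSubgroup n hϖ m hm)) : ℝ) ≤
      (((UniformAdmissibility.congruenceSubgroup n hϖ m hm).relIndex
        (UniformAdmissibility.integralGL F n) : ℕ) : ℝ) ^ n * (n : ℝ) ^ ((n : ℝ) / 2) ∧
    (3 ≤ n →
      (((UniformAdmissibility.congruenceSubgroup n hϖ m hm).relIndex
        (UniformAdmissibility.integralGL F n) : ℕ) : ℝ) ^ n * (n : ℝ) ^ ((n : ℝ) / 2) <
      (((UniformAdmissibility.congruenceSubgroup n hϖ m hm).relIndex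
        (UniformAdmissibility.integralGL F n) : ℕ) : ℝ) ^ (2 ^ (n - 1))) := by
  obtain ⟨l, rfl⟩ := Nat.exists_eq_add_of_le' hn
  exact ⟨UniformAdmissibility.finrank_fixedVectors_congruenceSubgroup_le hirr, fun hl =>
    UniformAdmissibility.pow_mul_rpow_lt_pow_two_pow hl
      (UniformAdmissibility.factorial_le_relIndex hϖ hm)⟩

theorem mainTheorem4 {F : Type*} [NontriviallyNormedField F] [IsUltrametricDist F]
    [LocallyCompactSpace F] (n : ℕ) (hn : 1 ≤ n)
    (ϖ : UniformAdmissibility.integers F) (hϖ : UniformAdmissibility.IsUniformizer ϖ)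
    (m : ℕ) (hm : 1 ≤ m)
    {V : Type*} [AddCommGroup V] [Module ℂ V] (π : Representation ℂ (GL (Fin n) F) V)
    (hirr : π.IsIrreducible) (hsm : UniformAdmissibility.IsSmooth π)
    (hadm : UniformAdmissibility.IsAdmissible π) :
    (Module.finrank ℂ (UniformAdmissibility.fixedVectors π
        (UniformAdmissibility.congruenceSubgroup n hϖ m hm)) : ℝ) ≤
      (((UniformAdmissibility.congruenceSubgroup n hϖ m hm).relIndex
        (UniformAdmissibility.integralGL F n) : ℕ) : ℝ) ^ n * (n : ℝ) ^ ((n : ℝ) / 2) ∧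
    (3 ≤ n →
      (((UniformAdmissibility.congruenceSubgroup n hϖ m hm).relIndex
        (UniformAdmissibility.integralGL F n) : ℕ) : ℝ) ^ n * (n : ℝ) ^ ((n : ℝ) / 2) <
      (((UniformAdmissibility.congruenceSubgroup n hϖ m hm).relIndex
        (UniformAdmissibility.integralGL F n) : ℕ) : ℝ) ^ (2 ^ (n - 1))) := by
  have := hadm _ (UniformAdmissibility.isOpen_congruenceSubgroup hϖ hm)
    (UniformAdmissibility.isCompact_congruenceSubgroup hϖ hm)
  exact mainTheorem4_general n hn ϖ hϖ m hm π hirr
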